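/- **Theorem (Strong optimality of the KL predictor in the exponential regime).** Let $\mathcal X$ be a compact set of decisions, $\Sigma$ a finite set of scenarios, $\mathcal P$ the probability simplex over $\Sigma$, $\mathcal P^{\mathrm o}=\{\mathbb P\in\mathcal P:\mathbb P(i)>0\ \forall i\}$ its relative interior, and $\ell:\mathcal X\times\Sigma\to\mathbb R$ a loss that is continuous in $x\in\mathcal X$ for each $i\in\Sigma$. Put $c(x,\mathbb P)=\sum_{i}\mathbb P(i)\ell(x,i)$. Let $\hat{\mathbb P}_T$ be the empirical distribution of the first $T$ samples of an i.i.d. sequence with law $\mathbb P$, and let $\mathbb P^\infty$ be the law of that sequence. A predictor is a sequence of functions $\hat c(\cdot,\cdot,T):\mathcal X\times\mathcal P\to\mathbb R$, $T\in\mathbb N_{\ge1}$. Consider the conditions 1. $(\hat c(\cdot,\cdot,T))_{T\ge1}$ is uniformly bounded and equicontinuous on $\mathcal X\times\mathcal P$; 2. for all $x$ and $T$, $\hat c(x,\cdot,T)$ is differentiable (along the simplex) at every $\mathbb P\in\mathcal P^{\mathrm o}$, and the derivatives are equicontinuous on $\mathcal X\times\mathcal P^{\mathrm o}$ and, for each compact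 $K\subset\mathcal P^{\mathrm o}$, bounded on $\mathcal X\times K$ uniformly in $T$. A predictor is regular if it satisfies 1 and 2. Given $(a_T)_{T\ge 1}$ in $[0,\infty)$, the predictor $\hat c$ satisfies the out-of-sample guarantee at $(x,\mathbb P)$ if $$\limsup_{T\to\infty}\frac1{a_T}\log\mathbb P^\infty\big(c(x,\mathbb P)>\hat c(x,\hat{\mathbb P}_T,T)\big)\le-1 .$$ Write $\hat c_1\preceq_{\mathcal C}\hat c_2$ if for all $x\in\mathcal X$ and $\mathbb P\in\mathcal P^{\mathrm o}$ $$\limsup_{T\to\infty}\frac{|\hat c_1(x,\mathbb P,T)-c(x,\mathbb P)|}{|\hat c_2(x,\mathbb P,T)-c(x,\mathbb P)|}\le1\qquad\Big(\tfrac00=1,\ \tfrac u0=\infty\text{ for }u>0\Big).$$ Let $r>0$ and $a_T/T\to r$, and let $$\hat c_{\mathrm{KL}}(x,\mathbb P,T)=\sup\Big\{c(x,\mathbb P'):\mathbb P'\in\mathcal P,\ \sum_{i}\mathbb P(i)\log\frac{\mathbb P(i)}{\mathbb P'(i)}\le r\Big\},$$ with $0\log(0/q)=0$ for $q\ge0$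 and $p\log(p/0)=\infty$ for $p>0$. Then: * $\hat c_{\mathrm{KL}}$ is regular; * $\hat c_{\mathrm{KL}}$ satisfies the out-of-sample guarantee at all $x\in\mathcal X$ and $\mathbb P\in\mathcal P$; * for every predictor $\hat c$ (which may depend on $T$) that satisfies condition 1, in particular for every regular $\hat c$, and that satisfies the out-of-sample guarantee at all $x\in\mathcal X$ and $\mathbb P\in\mathcal P^{\mathrm o}$, one has $\hat c_{\mathrm{KL}}\preceq_{\mathcal C}\hat c$. In particular $\hat c_{\mathrm{KL}}$ is strongly optimal. -/

import Mathlib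

open Filter Topology MeasureTheory

namespace DataDriven

/-- The probability simplex over the finite set of scenarios `S`. -/
abbrev Simplex (S : Type*) [Fintype S] : Type _ := ↥(stdSimplex ℝ S)

/-- The (relative) interior of the simplex: the distributions charging every scenario. -/
def simplexInterior (S : Type*) [Fintype S] : Set (Simplex S) :=
  {P | ∀ i, 0 < P i}

/-- The cost `c(x, P)`, the expectation of `ℓ(x, ξ)` when `ξ` is distributed as `P`. -/
def cost {X S : Type*} [Fintype S] (ℓ : X → S → ℝ) (x : X) (P : Simplex S) : ℝ :=
  ∑ i, P i * ℓ x i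

/-- Predictors `(x, P, T) ↦ ĉ(x, P, T)`, with data sizes `T` ranging over positive integers. -/
abbrev Predictor (X S : Type*) [Fintype S] : Type _ := X → Simplex S → ℕ+ → ℝ

/-! ### Sampling -/

/-- The probability measure on `S` with weights `P`. -/
noncomputable def simplexMeasure {S : Type*} [Fintype S] [MeasurableSpace S] (P : Simplex S) :
    Measure S :=
  ∑ i, ENNReal.ofReal (P i) • Measure.dirac i

instance simplexMeasure_isProbabilityMeasure {S : Type*} [Fintype S] [MeasurableSpace S]
    (P : Simplex S) : IsProbabilityMeasure (simplexMeasure P) := by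
  constructor
  have h : ∑ i, ENNReal.ofReal (P i) = 1 := by
    have h0 : ∀ i ∈ Finset.univ, 0 ≤ P i := fun i _ => P.2.1 i
    have h1 : ∑ i, P i = 1 := P.2.2
    rw [← ENNReal.ofReal_sum_of_nonneg h0, h1, ENNReal.ofReal_one]
  simpa [simplexMeasure] using h

/-- The law of an infinite i.i.d. sequence of samples from `P`. -/
noncomputable def sampleMeasure {S : Type*} [Fintype S] [MeasurableSpace S] (P : Simplex S) :
    Measure (ℕ → S) :=
  Measure.infinitePi (fun _ : ℕ => simplexMeasure P)

open Classical in
/-- The empirical distribution of the first `T` samples. -/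
noncomputable def empirical {S : Type*} [Fintype S] (T : ℕ+) (ω : ℕ → S) : Simplex S :=
  ⟨fun i => (((Finset.range T).filter (fun t => ω t = i)).card : ℝ) / (T : ℕ), by
    refine ⟨fun i => by positivity, ?_⟩
    have hT : ((T : ℕ) : ℝ) ≠ 0 := by exact_mod_cast T.ne_zero
    rw [← Finset.sum_div, div_eq_one_iff_eq hT, ← Nat.cast_sum,
      ← Finset.card_eq_sum_card_fiberwise (f := ω) (t := Finset.univ)
        (fun _ _ => Finset.mem_coe.2 (Finset.mem_univ _)), Finset.card_range]⟩

/-- The out-of-sample guarantee with speed `a`, for every decision and all true distributions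
in `D`.  The logarithm takes the value `-∞` at `0`. -/
def OutOfSampleGuarantee {X S : Type*} [Fintype S] [MeasurableSpace S] (ℓ : X → S → ℝ)
    (a : ℕ+ → ℝ) (D : Set (Simplex S)) (chat : Predictor X S) : Prop :=
  ∀ x : X, ∀ P ∈ D,
    limsup (fun T : ℕ+ =>
      ENNReal.log (sampleMeasure P {ω | cost ℓ x P > chat x (empirical T ω) T}) / (a T : EReal))
      atTop ≤ -1

/-! ### Regularity -/

/-- Uniform boundedness and equicontinuity of the sequence `ĉ(·, ·, T)` on `X × Simplex S`. -/
structure IsBoundedEquicontinuous {X S : Type*} [TopologicalSpace X] [Fintype S]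
    (chat : Predictor X S) : Prop where
  bounded : ∃ K : ℝ, ∀ (T : ℕ+) (x : X) (P : Simplex S), |chat x P T| ≤ K
  equicontinuous : Equicontinuous (fun (T : ℕ+) (z : X × Simplex S) => chat z.1 z.2 T)

/-- `g` is the gradient of `f` at `P` along the simplex: `f` is differentiable at `P` relative to
the simplex, and `g` represents the derivative on the tangent space of vectors summing to zero.
The normalization `∑ i, g i = 0` makes `g` unique at interior points. -/
def HasSimplexGradientAt {S : Type*} [Fintype S] (f : Simplex S → ℝ) (g : S → ℝ)
    (P : Simplex S) : Prop :=
  ∑ i, g i = 0 ∧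
    (fun Q : Simplex S =>
      f Q - f P - ∑ i, g i * (Q i - P i)) =o[𝓝 P]
    (fun Q : Simplex S => (fun i => Q i - P i : S → ℝ))

/-- Regular predictors: uniformly bounded and equicontinuous on the whole simplex, differentiable
in the distribution on the interior of the simplex, with derivatives that are uniformly bounded
over compact subsets of the interior and equicontinuous there. -/
structure IsRegularPredictor {X S : Type*} [TopologicalSpace X] [Fintype S]
    (chat : Predictor X S) : Prop extends IsBoundedEquicontinuous chat where
  differentiable : ∃ g : ℕ+ → X → Simplex S → (S → ℝ),
    (∀ (T : ℕ+) (x : X), ∀ P ∈ simplexInterior S,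
      HasSimplexGradientAt (fun Q => chat x Q T) (g T x P) P) ∧
    (∀ C : Set (Simplex S), IsCompact C → C ⊆ simplexInterior S →
      ∃ B : ℝ, ∀ (T : ℕ+) (x : X), ∀ P ∈ C, ‖g T x P‖ ≤ B) ∧
    EquicontinuousOn (fun (T : ℕ+) (z : X × Simplex S) => g T z.1 z.2)
      (Set.univ ×ˢ simplexInterior S)

/-! ### The order on predictors -/

open Classical in
/-- The quotient `u / v`, with `0 / 0 = 1` and `u / 0 = ∞` for `u ≠ 0`. -/
noncomputable def ratio (u v : ENNReal) : ENNReal :=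
  if u = 0 ∧ v = 0 then 1 else u / v

/-- `ĉ₁` is preferred to `ĉ₂`. -/
def Preferred {X S : Type*} [Fintype S] (ℓ : X → S → ℝ) (chat₁ chat₂ : Predictor X S) : Prop :=
  ∀ x : X, ∀ P ∈ simplexInterior S,
    limsup (fun T : ℕ+ =>
      ratio (ENNReal.ofReal |chat₁ x P T - cost ℓ x P|)
        (ENNReal.ofReal |chat₂ x P T - cost ℓ x P|)) atTop ≤ 1

/-! ### The Kullback–Leibler predictor -/

open Classical in
/-- `p log (p / q)`, with `0 log (0 / q) = 0` and `p log (p / 0) = ∞` for `p > 0`. -/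
noncomputable def relEntropyTerm (p q : ℝ) : EReal :=
  if p = 0 then 0 else if q = 0 then ⊤ else ((p * Real.log (p / q) : ℝ) : EReal)

/-- The relative entropy `I(P, Q) = ∑ i, P(i) log (P(i) / Q(i))`. -/
noncomputable def relEntropy {S : Type*} [Fintype S] (P Q : Simplex S) : EReal :=
  ∑ i, relEntropyTerm (P i) (Q i)

/-- The distributionally robust predictor over relative entropy balls of radius `r`. -/
noncomputable def klPredictor {X S : Type*} [Fintype S] (ℓ : X → S → ℝ) (r : ℝ) :
    Predictor X S :=
  fun x P _ => sSup (cost ℓ x '' {Q : Simplex S | relEntropy P Q ≤ (r : EReal)})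

end DataDriven

/-!
The entropy-robust predictor is `f(x, P) = max {c(x, Q) : I(P, Q) ≤ r}`.

*Regularity.*  The entropy balls form a closed relation between centre and member
(`isClosed_setOf_relEntropy_le`), so `f` is upper semicontinuous by compactness; every member of a
ball is approximated by interior points of the simplex at entropy strictly below `r`
(`exists_interior_of_lt_cost`), and these remain in the ball when the centre moves slightly, so `f`
is lower semicontinuous, up to the boundary of the simplex.  At an interior `P`, if the loss is not
constant in the scenario, the intermediate value theorem provides a stationary point `Q` with a
multiplier `λ` (`exists_isEntropyOptimal`), and the tangent inequality for `p log (p / q)` shows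
at once that `Q` is the unique maximizer and that `-λ log (P / Q)` is a supergradient of `f(x, ·)`
at `P` (`IsEntropyOptimal.sum_mul_le`, `IsEntropyOptimal.eq_of_le`).  A supergradient that depends
continuously on the point is a gradient (`hasSimplexGradientAt_of_isSupergradient`).  Continuity in
`(x, P)` follows from the uniqueness of `Q` where the loss is not constant; where it is constant
the gradient vanishes, and nearby supergradients are small because the oscillation of `f` is
(`IsSupergradient.norm_le`).

*Guarantee.*  If `c(x, P)` exceeds the prediction, then `P` is outside the ball around the empirical
distribution.  By the method of types this has probability at most `(T + 1) ^ |S| * exp (-r T)`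
(`sampleMeasure_lt_relEntropy_le`).

*Optimality.*  If `f` is not preferred to a predictor with the guarantee, then at some `(x, P)` that
predictor is infinitely often below `f(x, P)` by a fixed margin.  Choose an interior `R` with
`I(P, R) < r` whose cost is nearly `f(x, P)`.  By equicontinuity the predictor underestimates the
cost of `R` whenever the empirical distribution is close to `P`; under `R` this has probability at
least `exp (-b T) / 2` for some `b < r`, by a change of measure and the law of large numbers
(`sampleMeasure_change`, `tendsto_sampleMeasure_empirical_mem`), which contradicts the guarantee
at `R`.
-/

namespace DataDriven

/-! ### Relative entropy as a real number -/

section Entropy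

variable {S : Type*} [Fintype S]

lemma simplex_nonneg (P : Simplex S) (i : S) : 0 ≤ P i := P.2.1 i

lemma simplex_sum (P : Simplex S) : ∑ i, P i = 1 := P.2.2

lemma simplex_le_one (P : Simplex S) (i : S) : P i ≤ 1 :=
  (mem_Icc_of_mem_stdSimplex P.2 i).2

lemma simplex_ext {P Q : Simplex S} (h : ∀ i, P i = Q i) : P = Q :=
  Subtype.ext (funext h)

@[fun_prop]
lemma continuous_simplex_apply (i : S) : Continuous (fun P : Simplex S => P i) :=
  (continuous_apply i).comp continuous_subtype_val

lemma isOpen_simplexInterior : IsOpen (simplexInterior S) := by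
  have : simplexInterior S = ⋂ i, {P : Simplex S | 0 < P i} := by
    ext P; simp [simplexInterior]
  rw [this]
  exact isOpen_iInter_of_finite fun i =>
    isOpen_lt continuous_const (continuous_simplex_apply i)

lemma nonempty_of_simplex (P : Simplex S) : Nonempty S := by
  by_contra h
  rw [not_nonempty_iff] at h
  simpa using simplex_sum P

/-- The real sum `∑ i, P i log (P i / Q i)`.  By the conventions for division and logarithm, the
terms with `P i = 0` or `Q i = 0` vanish, so this is the relative entropy only when the support of
`P` is contained in that of `Q`. -/
noncomputable def klSum (P Q : Simplex S) : ℝ := ∑ i, P i * Real.log (P i / Q i)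

lemma relEntropyTerm_ne_bot (p q : ℝ) : relEntropyTerm p q ≠ ⊥ := by
  unfold relEntropyTerm
  split_ifs
  exacts [EReal.zero_ne_bot, bot_lt_top.ne', EReal.coe_ne_bot _]

lemma relEntropy_eq_klSum {P Q : Simplex S} (h : ∀ i, Q i = 0 → P i = 0) :
    relEntropy P Q = (klSum P Q : EReal) := by
  unfold relEntropy klSum
  have hc : ∀ s : Finset S, ((∑ i ∈ s, P i * Real.log (P i / Q i) : ℝ) : EReal)
      = ∑ i ∈ s, ((P i * Real.log (P i / Q i) : ℝ) : EReal) := by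
    intro s
    induction s using Finset.cons_induction with
    | empty => simp
    | cons a s ha ih => rw [Finset.sum_cons, Finset.sum_cons, EReal.coe_add, ih]
  rw [hc]
  refine Finset.sum_congr rfl fun i _ => ?_
  unfold relEntropyTerm
  split_ifs with h1 h2
  · simp [h1]
  · exact absurd (h i h2) h1
  · rfl

lemma relEntropy_eq_top {P Q : Simplex S} {i : S} (hq : Q i = 0) (hp : P i ≠ 0) :
    relEntropy P Q = ⊤ := by
  classical
  unfold relEntropy
  have hb : ∀ s : Finset S, ∑ j ∈ s, relEntropyTerm (P j) (Q j) ≠ ⊥ := by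
    intro s
    induction s using Finset.cons_induction with
    | empty => simp
    | cons a s ha ih =>
      rw [Finset.sum_cons, Ne, EReal.add_eq_bot_iff]
      exact fun h => h.elim (relEntropyTerm_ne_bot _ _) ih
  rw [← Finset.add_sum_erase _ _ (Finset.mem_univ i)]
  have : relEntropyTerm (P i) (Q i) = ⊤ := by simp [relEntropyTerm, hq, hp]
  rw [this, EReal.top_add_of_ne_bot (hb _)]

lemma relEntropy_le_iff {P Q : Simplex S} {r : ℝ} :
    relEntropy P Q ≤ (r : EReal) ↔ (∀ i, Q i = 0 → P i = 0) ∧ klSum P Q ≤ r := by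
  by_cases h : ∀ i, Q i = 0 → P i = 0
  · rw [relEntropy_eq_klSum h, EReal.coe_le_coe_iff]
    exact ⟨fun h' => ⟨h, h'⟩, fun h' => h'.2⟩
  · refine ⟨fun h' => ?_, fun h' => absurd h'.1 h⟩
    push Not at h
    obtain ⟨i, hq, hp⟩ := h
    rw [relEntropy_eq_top hq hp] at h'
    simp at h'

lemma klSum_eq {P Q : Simplex S} (h : ∀ i, Q i = 0 → P i = 0) :
    klSum P Q = ∑ i, P i * Real.log (P i) - ∑ i, P i * Real.log (Q i) := by
  rw [← Finset.sum_sub_distrib]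
  refine Finset.sum_congr rfl fun i _ => ?_
  by_cases hp : P i = 0
  · simp [hp]
  · rw [Real.log_div hp fun hq => hp (h i hq)]
    ring

lemma klSum_self (P : Simplex S) : klSum P P = 0 := by
  refine Finset.sum_eq_zero fun i _ => ?_
  by_cases hp : P i = 0 <;> simp [hp]

lemma continuous_klSum_left {Q : Simplex S} (hQ : Q ∈ simplexInterior S) :
    Continuous (fun P : Simplex S => klSum P Q) := by
  have : (fun P : Simplex S => klSum P Q)
      = fun P => ∑ i, P i * Real.log (P i) - ∑ i, P i * Real.log (Q i) := by
    funext P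
    exact klSum_eq fun i hi => absurd hi (hQ i).ne'
  rw [this]
  refine Continuous.sub (continuous_finsetSum _ fun i _ => ?_) (by fun_prop)
  exact Real.continuous_mul_log.comp (continuous_simplex_apply i)

/-- Truncating the logarithm of the second argument writes the entropy balls as an intersection
of closed conditions, without a case distinction at the boundary of the simplex. -/
lemma relEntropy_le_iff_forall_truncated {P Q : Simplex S} {r : ℝ} :
    relEntropy P Q ≤ (r : EReal) ↔ ∀ δ : ℝ, δ ∈ Set.Ioc 0 1 →
      ∑ i, P i * Real.log (P i) - ∑ i, P i * Real.log (max (Q i) δ) ≤ r := by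
  rw [relEntropy_le_iff]
  constructor
  · rintro ⟨h, hr⟩ δ hδ
    rw [klSum_eq h] at hr
    have : ∑ i, P i * Real.log (Q i) ≤ ∑ i, P i * Real.log (max (Q i) δ) := by
      refine Finset.sum_le_sum fun i _ => ?_
      rcases (simplex_nonneg Q i).eq_or_lt with hq | hq
      · simp [h i hq.symm]
      · exact mul_le_mul_of_nonneg_left (Real.log_le_log hq (le_max_left _ _))
          (simplex_nonneg P i)
    linarith
  · intro h
    have hsupp : ∀ i, Q i = 0 → P i = 0 := by
      intro i hq
      by_contra hp
      have hp : 0 < P i := lt_of_le_of_ne (simplex_nonneg P i) (Ne.symm hp)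
      -- at this `δ` the term of index `i` alone exceeds the bound
      set A := ∑ i, P i * Real.log (P i) with hA
      set t := (|A| + |r| + 1) / P i with ht
      have ht0 : 0 < t := by positivity
      have hle : Real.exp (-t) ≤ 1 := Real.exp_le_one_iff.2 (by linarith)
      have h1 := h (Real.exp (-t)) ⟨Real.exp_pos _, hle⟩
      have h2 : ∑ j, P j * Real.log (max (Q j) (Real.exp (-t)))
          ≤ P i * Real.log (max (Q i) (Real.exp (-t))) := by
        classical
        rw [← Finset.add_sum_erase _ _ (Finset.mem_univ i)]
        have : ∑ j ∈ Finset.univ.erase i, P j * Real.log (max (Q j) (Real.exp (-t))) ≤ 0 := by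
          refine Finset.sum_nonpos fun j _ => ?_
          refine mul_nonpos_of_nonneg_of_nonpos (simplex_nonneg P j) ?_
          exact Real.log_nonpos (by positivity) (max_le (simplex_le_one Q j) hle)
        linarith
      rw [hq, max_eq_right (Real.exp_pos _).le, Real.log_exp] at h2
      have h3 : P i * -t = -(|A| + |r| + 1) := by rw [ht]; field_simp
      have := neg_abs_le A
      have := le_abs_self r
      linarith
    refine ⟨hsupp, ?_⟩
    obtain ⟨δ, hδ, hδQ⟩ : ∃ δ ∈ Set.Ioc (0 : ℝ) 1, ∀ i, 0 < Q i → δ ≤ Q i := by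
      have hev : ∀ᶠ δ in 𝓝[>] (0 : ℝ), ∀ i, 0 < Q i → δ ≤ Q i := by
        refine eventually_all.2 fun i => ?_
        by_cases hq : 0 < Q i
        · filter_upwards [Ioo_mem_nhdsGT hq] with δ hδ _ using hδ.2.le
        · exact Eventually.of_forall fun _ h => absurd h hq
      obtain ⟨δ, h1, h2⟩ := (hev.and (Ioc_mem_nhdsGT one_pos)).exists
      exact ⟨δ, h2, h1⟩
    rw [klSum_eq hsupp]
    convert h δ hδ using 2
    refine Finset.sum_congr rfl fun i _ => ?_
    rcases (simplex_nonneg Q i).eq_or_lt with hq | hq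
    · simp [hsupp i hq.symm]
    · rw [max_eq_left (hδQ i hq)]

lemma isClosed_setOf_relEntropy_le (r : ℝ) :
    IsClosed {z : Simplex S × Simplex S | relEntropy z.1 z.2 ≤ (r : EReal)} := by
  simp_rw [relEntropy_le_iff_forall_truncated, Set.ofPred_forall]
  refine isClosed_iInter fun δ => isClosed_iInter fun hδ => ?_
  refine isClosed_le ?_ continuous_const
  refine Continuous.sub (continuous_finsetSum _ fun i _ => ?_)
    (continuous_finsetSum _ fun i _ => ?_)
  · exact Real.continuous_mul_log.comp ((continuous_simplex_apply i).comp continuous_fst)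
  · refine ((continuous_simplex_apply i).comp continuous_fst).mul ?_
    refine Continuous.log ?_ fun z => (lt_max_of_lt_right hδ.1).ne'
    exact ((continuous_simplex_apply i).comp continuous_snd).max continuous_const

/-! ### Mixtures -/

/-- The mixture `(1 - t) Q + t R`. -/
noncomputable def mix (t : ℝ) (h0 : 0 ≤ t) (h1 : t ≤ 1) (Q R : Simplex S) : Simplex S :=
  ⟨fun i => (1 - t) * Q i + t * R i, by
    have := convex_stdSimplex ℝ S Q.2 R.2 (sub_nonneg.2 h1) h0 (by ring)
    exact this⟩

lemma mix_apply (t : ℝ) (h0 : 0 ≤ t) (h1 : t ≤ 1) (Q R : Simplex S) (i : S) :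
    mix t h0 h1 Q R i = (1 - t) * Q i + t * R i := rfl

lemma cost_mix {X : Type*} (ℓ : X → S → ℝ) (x : X) (t : ℝ) (h0 : 0 ≤ t) (h1 : t ≤ 1)
    (Q R : Simplex S) :
    cost ℓ x (mix t h0 h1 Q R) = (1 - t) * cost ℓ x Q + t * cost ℓ x R := by
  simp only [cost, mix_apply, Finset.mul_sum, ← Finset.sum_add_distrib]
  exact Finset.sum_congr rfl fun i _ => by ring

/-- Every entropy ball of positive radius has a strictly feasible interior point. -/
lemma exists_interior_klSum_lt (P : Simplex S) {r : ℝ} (hr : 0 < r) :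
    ∃ R ∈ simplexInterior S, klSum P R < r := by
  classical
  have := nonempty_of_simplex P
  set U : Simplex S := stdSimplex.barycenter
  have hUi : ∀ i, 0 < U i := fun i => by
    change 0 < (Fintype.card S : ℝ)⁻¹
    positivity
  have he : Real.exp (-(r / 2)) < 1 := by rw [Real.exp_lt_one_iff]; linarith
  have he0 := Real.exp_pos (-(r / 2))
  -- a mixture keeping the share `exp (-(r / 2))` of `P` is at relative entropy at most `r / 2`
  set s := 1 - Real.exp (-(r / 2)) with hs
  have hs0 : 0 ≤ s := by linarith
  have hs1 : s ≤ 1 := by linarith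
  have h1 : ∀ i, Real.exp (-(r / 2)) * P i ≤ mix s hs0 hs1 P U i := fun i => by
    rw [mix_apply, hs]
    have := mul_nonneg hs0 (hUi i).le
    rw [hs] at this
    linarith
  have hint : mix s hs0 hs1 P U ∈ simplexInterior S := fun i => by
    rw [mix_apply]
    have := mul_pos (show 0 < s by linarith) (hUi i)
    have := mul_nonneg (sub_nonneg.2 hs1) (simplex_nonneg P i)
    linarith
  refine ⟨mix s hs0 hs1 P U, hint, ?_⟩
  have h2 : klSum P (mix s hs0 hs1 P U) ≤ ∑ i, P i * (r / 2) := by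
    refine Finset.sum_le_sum fun i _ => ?_
    rcases (simplex_nonneg P i).eq_or_lt with hp | hp
    · simp [← hp]
    · refine mul_le_mul_of_nonneg_left ?_ hp.le
      rw [Real.log_le_iff_le_exp (div_pos hp (hint i)), div_le_iff₀ (hint i)]
      calc P i = Real.exp (r / 2) * (Real.exp (-(r / 2)) * P i) := by
            rw [← mul_assoc, ← Real.exp_add]; simp
        _ ≤ _ := by gcongr; exact h1 i
  rw [← Finset.sum_mul, simplex_sum] at h2
  linarith

lemma klSum_mix_le {P Q R : Simplex S} (hQ : ∀ i, Q i = 0 → P i = 0)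
    (hR : R ∈ simplexInterior S) {t : ℝ} (h0 : 0 < t) (h1 : t ≤ 1) :
    klSum P (mix t h0.le h1 Q R) ≤ (1 - t) * klSum P Q + t * klSum P R := by
  simp only [klSum, Finset.mul_sum, ← Finset.sum_add_distrib]
  refine Finset.sum_le_sum fun i _ => ?_
  rcases (simplex_nonneg P i).eq_or_lt with hp | hp
  · simp [← hp]
  · have hq : 0 < Q i := lt_of_le_of_ne (simplex_nonneg Q i) fun h => hp.ne' (hQ i h.symm)
    have hr := hR i
    have hm : 0 < (1 - t) * Q i + t * R i := by
      have := mul_pos h0 hr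
      have := mul_nonneg (sub_nonneg.2 h1) hq.le
      linarith
    rw [mix_apply, Real.log_div hp.ne' hm.ne', Real.log_div hp.ne' hq.ne',
      Real.log_div hp.ne' hr.ne']
    have hc := strictConcaveOn_log_Ioi.concaveOn.2 (Set.mem_Ioi.2 hq) (Set.mem_Ioi.2 hr)
      (sub_nonneg.2 h1) h0.le (by ring)
    simp only [smul_eq_mul] at hc
    have := mul_le_mul_of_nonneg_left hc hp.le
    linarith

/-- The entropy ball is the closure of its strictly feasible interior points, as seen by the
cost. -/
lemma exists_interior_of_lt_cost {X : Type*} (ℓ : X → S → ℝ) (x : X) {P Q : Simplex S} {r c : ℝ}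
    (hr : 0 < r) (hQ : relEntropy P Q ≤ (r : EReal)) (hc : c < cost ℓ x Q) :
    ∃ R ∈ simplexInterior S, klSum P R < r ∧ c < cost ℓ x R := by
  obtain ⟨hs, hk⟩ := relEntropy_le_iff.1 hQ
  obtain ⟨R, hR, hRr⟩ := exists_interior_klSum_lt P hr
  have htend : Tendsto (fun t : ℝ => (1 - t) * cost ℓ x Q + t * cost ℓ x R) (𝓝[>] 0)
      (𝓝 (cost ℓ x Q)) := by
    have : Continuous (fun t : ℝ => (1 - t) * cost ℓ x Q + t * cost ℓ x R) := by fun_prop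
    have h0 := (this.tendsto 0).mono_left (nhdsWithin_le_nhds (s := Set.Ioi 0))
    simpa using h0
  obtain ⟨t, htc, h0, h1⟩ := ((htend.eventually (lt_mem_nhds hc)).and
    (Ioc_mem_nhdsGT one_pos)).exists
  refine ⟨mix t h0.le h1 Q R, fun i => ?_, ?_, ?_⟩
  · rw [mix_apply]
    have := mul_pos h0 (hR i)
    have := mul_nonneg (sub_nonneg.2 h1) (simplex_nonneg Q i)
    linarith
  · refine (klSum_mix_le hs hR h0 h1).trans_lt ?_
    have := mul_le_mul_of_nonneg_left hk (sub_nonneg.2 h1)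
    have := mul_lt_mul_of_pos_left hRr h0
    linarith
  · rw [cost_mix]
    exact htc

end Entropy

/-! ### The Kullback–Leibler predictor as a maximum -/

section Predictor

variable {X S : Type*} [Fintype S]

lemma cost_sub_const (ℓ : X → S → ℝ) (x : X) (P : Simplex S) (c : ℝ) :
    cost ℓ x P - c = ∑ i, P i * (ℓ x i - c) := by
  simp only [cost, mul_sub, Finset.sum_sub_distrib, ← Finset.sum_mul, simplex_sum, one_mul]

lemma abs_cost_sub_le (ℓ : X → S → ℝ) (x : X) (P : Simplex S) (c : ℝ) :
    |cost ℓ x P - c| ≤ ∑ i, |ℓ x i - c| := by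
  rw [cost_sub_const]
  refine (Finset.abs_sum_le_sum_abs _ _).trans (Finset.sum_le_sum fun i _ => ?_)
  rw [abs_mul, abs_of_nonneg (simplex_nonneg P i)]
  exact mul_le_of_le_one_left (abs_nonneg _) (simplex_le_one P i)

lemma continuous_cost_right (ℓ : X → S → ℝ) (x : X) :
    Continuous (fun P : Simplex S => cost ℓ x P) :=
  continuous_finsetSum _ fun i _ => (continuous_simplex_apply i).mul continuous_const

lemma continuous_cost [TopologicalSpace X] {ℓ : X → S → ℝ}
    (hℓ : ∀ i, Continuous fun x => ℓ x i) :
    Continuous (fun z : X × Simplex S => cost ℓ z.1 z.2) :=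
  continuous_finsetSum _ fun i _ =>
    ((continuous_simplex_apply i).comp continuous_snd).mul ((hℓ i).comp continuous_fst)

lemma relEntropy_self_le (P : Simplex S) {r : ℝ} (hr : 0 ≤ r) :
    relEntropy P P ≤ (r : EReal) :=
  relEntropy_le_iff.2 ⟨fun _ h => h, by rwa [klSum_self]⟩

lemma bddAbove_cost_image (ℓ : X → S → ℝ) (x : X) (A : Set (Simplex S)) :
    BddAbove (cost ℓ x '' A) := by
  refine ⟨∑ i, |ℓ x i - 0|, ?_⟩
  rintro _ ⟨Q, -, rfl⟩
  simpa using (le_abs_self _).trans (abs_cost_sub_le ℓ x Q 0)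

lemma cost_le_klPredictor (ℓ : X → S → ℝ) {r : ℝ} (x : X) {P Q : Simplex S} (T : ℕ+)
    (h : relEntropy P Q ≤ (r : EReal)) : cost ℓ x Q ≤ klPredictor ℓ r x P T :=
  le_csSup (bddAbove_cost_image ℓ x _) ⟨Q, h, rfl⟩

lemma klPredictor_le (ℓ : X → S → ℝ) {r : ℝ} (hr : 0 ≤ r) (x : X) {P : Simplex S} (T : ℕ+) {c : ℝ}
    (h : ∀ Q, relEntropy P Q ≤ (r : EReal) → cost ℓ x Q ≤ c) : klPredictor ℓ r x P T ≤ c := by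
  refine csSup_le ⟨_, P, relEntropy_self_le P hr, rfl⟩ ?_
  rintro _ ⟨Q, hQ, rfl⟩
  exact h Q hQ

lemma exists_cost_eq_klPredictor (ℓ : X → S → ℝ) {r : ℝ} (hr : 0 ≤ r) (x : X) (P : Simplex S)
    (T : ℕ+) : ∃ Q, relEntropy P Q ≤ (r : EReal) ∧ cost ℓ x Q = klPredictor ℓ r x P T := by
  have hc : IsClosed {Q : Simplex S | relEntropy P Q ≤ (r : EReal)} :=
    (isClosed_setOf_relEntropy_le r).preimage (by fun_prop : Continuous fun Q => (P, Q))
  obtain ⟨Q, hQ, hmax⟩ := hc.isCompact.exists_isMaxOn ⟨P, relEntropy_self_le P hr⟩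
    (continuous_cost_right ℓ x).continuousOn
  exact ⟨Q, hQ, le_antisymm (cost_le_klPredictor ℓ x T hQ) (klPredictor_le ℓ hr x T hmax)⟩

lemma abs_klPredictor_sub_le (ℓ : X → S → ℝ) {r : ℝ} (hr : 0 ≤ r) (x : X) (P : Simplex S) (T : ℕ+)
    (c : ℝ) : |klPredictor ℓ r x P T - c| ≤ ∑ i, |ℓ x i - c| := by
  obtain ⟨Q, -, hQ⟩ := exists_cost_eq_klPredictor ℓ hr x P T
  rw [← hQ]
  exact abs_cost_sub_le ℓ x Q c

lemma continuous_klPredictor [TopologicalSpace X] {ℓ : X → S → ℝ}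
    (hℓ : ∀ i, Continuous fun x => ℓ x i) {r : ℝ} (hr : 0 < r) (T : ℕ+) :
    Continuous (fun z : X × Simplex S => klPredictor ℓ r z.1 z.2 T) := by
  refine continuous_iff_continuousAt.2 fun z₀ => tendsto_order.2 ⟨fun c hc => ?_, fun c hc => ?_⟩
  · obtain ⟨Q, hQ, hQc⟩ := exists_cost_eq_klPredictor ℓ hr.le z₀.1 z₀.2 T
    have hc : c < klPredictor ℓ r z₀.1 z₀.2 T := hc
    rw [← hQc] at hc
    obtain ⟨R, hR, hRr, hRc⟩ := exists_interior_of_lt_cost ℓ z₀.1 hr hQ hc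
    have h1 : ∀ᶠ z in 𝓝 z₀, klSum z.2 R < r :=
      ((continuous_klSum_left hR).comp continuous_snd).continuousAt.eventually (gt_mem_nhds hRr)
    have h2 : ∀ᶠ z in 𝓝 z₀, c < cost ℓ z.1 R :=
      ((continuous_cost hℓ).comp (by fun_prop : Continuous fun z : X × Simplex S => (z.1, R))
        ).continuousAt.eventually (lt_mem_nhds hRc)
    filter_upwards [h1, h2] with z hz1 hz2
    exact hz2.trans_le (cost_le_klPredictor ℓ z.1 T
      (relEntropy_le_iff.2 ⟨fun i hi => absurd hi (hR i).ne', hz1.le⟩))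
  · -- the superlevel set is the projection of a closed set along the compact simplex
    have hcl : IsClosed {w : (X × Simplex S) × Simplex S |
        relEntropy w.1.2 w.2 ≤ (r : EReal) ∧ c ≤ cost ℓ w.1.1 w.2} :=
      ((isClosed_setOf_relEntropy_le r).preimage
        (by fun_prop : Continuous fun w : (X × Simplex S) × Simplex S => (w.1.2, w.2))).inter
        (isClosed_le continuous_const ((continuous_cost hℓ).comp
          (by fun_prop : Continuous fun w : (X × Simplex S) × Simplex S => (w.1.1, w.2))))
    have himg := isClosedMap_fst_of_compactSpace _ hcl
    have hz₀ : z₀ ∈ (Prod.fst '' {w : (X × Simplex S) × Simplex S |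
        relEntropy w.1.2 w.2 ≤ (r : EReal) ∧ c ≤ cost ℓ w.1.1 w.2})ᶜ := by
      rintro ⟨⟨w, Q⟩, ⟨h1, h2⟩, rfl⟩
      exact (h2.trans (cost_le_klPredictor ℓ w.1 T h1)).not_gt hc
    filter_upwards [himg.isOpen_compl.mem_nhds hz₀] with z hz
    by_contra h
    push Not at h
    obtain ⟨Q, hQ, hQc⟩ := exists_cost_eq_klPredictor ℓ hr.le z.1 z.2 T
    exact hz ⟨(z, Q), ⟨hQ, hQc ▸ h⟩, rfl⟩

lemma isBoundedEquicontinuous_klPredictor [TopologicalSpace X] [CompactSpace X] {ℓ : X → S → ℝ}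
    (hℓ : ∀ i, Continuous fun x => ℓ x i) {r : ℝ} (hr : 0 < r) :
    IsBoundedEquicontinuous (klPredictor ℓ r) := by
  refine ⟨?_, ?_⟩
  · have hc : Continuous fun x => ∑ i, |ℓ x i - 0| :=
      continuous_finsetSum _ fun i _ => ((hℓ i).sub continuous_const).abs
    obtain ⟨K, hK⟩ := isCompact_univ.bddAbove_image hc.continuousOn
    refine ⟨K, fun T x P => ?_⟩
    have := abs_klPredictor_sub_le ℓ hr.le x P T 0
    rw [sub_zero] at this
    exact this.trans (hK ⟨x, Set.mem_univ x, rfl⟩)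
  · intro z₀ U hU
    filter_upwards [(continuous_klPredictor hℓ hr 1).continuousAt
      (UniformSpace.ball_mem_nhds _ hU)] with z hz T
    exact hz

end Predictor

/-! ### Optimality conditions over entropy balls -/

section KKT

variable {S : Type*} [Fintype S]

/-- Multipliers certifying that `Q` maximizes `∑ i, Q i * l i` over the relative entropy ball of
radius `r` around `P`: `lam` is the multiplier of the entropy constraint and `mu` the one of the
normalization `∑ i, Q i = 1`. -/
structure IsEntropyOptimal (l : S → ℝ) (r : ℝ) (P Q : Simplex S) (lam mu : ℝ) : Prop where
  center_pos : P ∈ simplexInterior S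
  interior : Q ∈ simplexInterior S
  lam_pos : 0 < lam
  stationary : ∀ i, l i + lam * (P i / Q i) = mu
  tight : klSum P Q = r

/-- For a non-constant objective, multipliers exist at every interior `P`.  The stationary points
form the curve `Q i ∝ P i / (1 + u (l m - l i))`, `u ≥ 0`, with `l m` the largest value of `l`;
along it the relative entropy is continuous, starts at `0` and is unbounded. -/
lemma exists_isEntropyOptimal {l : S → ℝ} (hl : ∃ i j, l i ≠ l j) {r : ℝ} (hr : 0 < r)
    {P : Simplex S} (hP : P ∈ simplexInterior S) :
    ∃ Q lam mu, IsEntropyOptimal l r P Q lam mu := by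
  have := nonempty_of_simplex P
  obtain ⟨m, hm⟩ := Finite.exists_max l
  obtain ⟨k, hk⟩ : ∃ k, l k < l m := by
    by_contra h
    push Not at h
    obtain ⟨i, j, hij⟩ := hl
    exact hij (((hm i).antisymm (h i)).trans ((hm j).antisymm (h j)).symm)
  set d : S → ℝ := fun i => l m - l i with hd
  have hd0 : ∀ i, 0 ≤ d i := fun i => sub_nonneg.2 (hm i)
  have hdk : 0 < d k := sub_pos.2 hk
  have hw : ∀ u : ℝ, 0 ≤ u → ∀ i, 0 < 1 + u * d i := fun u hu i => by
    have := mul_nonneg hu (hd0 i); linarith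
  have hZ : ∀ u : ℝ, 0 ≤ u → 0 < ∑ i, P i / (1 + u * d i) := fun u hu =>
    Finset.sum_pos (fun i _ => div_pos (hP i) (hw u hu i)) Finset.univ_nonempty
  set φ : ℝ → ℝ := fun u => ∑ i, P i * Real.log (1 + u * d i)
    + Real.log (∑ i, P i / (1 + u * d i)) with hφ
  -- at `u₁` the `k`-th logarithm alone compensates the lower bound `log (P m)` of the second term
  set u₁ : ℝ := (Real.exp ((r - Real.log (P m)) / P k) - 1) / d k with hu₁
  have hPm : Real.log (P m) ≤ 0 := Real.log_nonpos (hP m).le (simplex_le_one P m)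
  have hu₁0 : 0 ≤ u₁ := by
    refine div_nonneg (sub_nonneg.2 (Real.one_le_exp ?_)) hdk.le
    exact div_nonneg (by linarith) (hP k).le
  have hφ0 : φ 0 = 0 := by simp [hφ]
  have hφ1 : r ≤ φ u₁ := by
    have h1 : P k * Real.log (1 + u₁ * d k) ≤ ∑ i, P i * Real.log (1 + u₁ * d i) := by
      refine Finset.single_le_sum (f := fun i => P i * Real.log (1 + u₁ * d i))
        (fun i _ => mul_nonneg (hP i).le (Real.log_nonneg ?_)) (Finset.mem_univ k)
      have := mul_nonneg hu₁0 (hd0 i); linarith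
    have h2 : P k * Real.log (1 + u₁ * d k) = r - Real.log (P m) := by
      have : 1 + u₁ * d k = Real.exp ((r - Real.log (P m)) / P k) := by
        rw [hu₁, div_mul_cancel₀ _ hdk.ne']; ring
      rw [this, Real.log_exp, mul_div_cancel₀ _ (hP k).ne']
    have h3 : Real.log (P m) ≤ Real.log (∑ i, P i / (1 + u₁ * d i)) := by
      refine Real.log_le_log (hP m) ?_
      have := Finset.single_le_sum (f := fun i => P i / (1 + u₁ * d i))
        (fun i _ => (div_pos (hP i) (hw u₁ hu₁0 i)).le) (Finset.mem_univ m)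
      simpa [hd] using this
    simp only [hφ]
    linarith
  have hcont : ContinuousOn φ (Set.Icc 0 u₁) := by
    refine ContinuousOn.add (continuousOn_finsetSum _ fun i _ => ?_) ?_
    · refine continuousOn_const.mul (ContinuousOn.log (by fun_prop) fun u hu => ?_)
      exact (hw u hu.1 i).ne'
    · refine ContinuousOn.log (continuousOn_finsetSum _ fun i _ => ?_) fun u hu => (hZ u hu.1).ne'
      exact continuousOn_const.div (by fun_prop) fun u hu => (hw u hu.1 i).ne'
  obtain ⟨u, ⟨hu0, -⟩, hur⟩ : r ∈ φ '' Set.Icc 0 u₁ :=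
    intermediate_value_Icc hu₁0 hcont ⟨hφ0.trans_le hr.le, hφ1⟩
  have hu : 0 < u := lt_of_le_of_ne hu0 fun h => by
    rw [← h, hφ0] at hur; exact hr.ne hur
  set Z := ∑ i, P i / (1 + u * d i) with hZdef
  have hZ0 : 0 < Z := hZ u hu0
  let Q : Simplex S := ⟨fun i => P i / (1 + u * d i) / Z,
    fun i => (div_pos (div_pos (hP i) (hw u hu0 i)) hZ0).le, by
      rw [← Finset.sum_div, ← hZdef, div_self hZ0.ne']⟩
  have hQ : ∀ i, Q i = P i / (1 + u * d i) / Z := fun i => rfl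
  have hratio : ∀ i, P i / Q i = Z * (1 + u * d i) := fun i => by
    have h1 := (hw u hu0 i).ne'
    have h2 := (hP i).ne'
    rw [hQ]
    field_simp
  refine ⟨Q, 1 / (u * Z), l m + 1 / u, hP,
    fun i => div_pos (div_pos (hP i) (hw u hu0 i)) hZ0, by positivity, fun i => ?_, ?_⟩
  · rw [hratio]
    simp only [hd]
    field_simp
    ring
  · rw [← hur]
    simp only [klSum, hratio, hφ]
    rw [← hZdef]
    have : ∀ i, P i * Real.log (Z * (1 + u * d i))
        = P i * Real.log (1 + u * d i) + P i * Real.log Z := fun i => by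
      rw [Real.log_mul hZ0.ne' (hw u hu0 i).ne']; ring
    simp only [this, Finset.sum_add_distrib, ← Finset.sum_mul, simplex_sum, one_mul]

/-- The tangent bound of `(p, q) ↦ p log (p / q)` along the ray of slope `w`. -/
lemma mul_log_div_ge {p q w : ℝ} (hp : 0 ≤ p) (hq : 0 ≤ q) (h : q = 0 → p = 0) (hw : 0 < w) :
    p * Real.log w + p - q * w ≤ p * Real.log (p / q) := by
  rcases hp.eq_or_lt with hp | hp
  · rw [← hp]
    have := mul_nonneg hq hw.le
    simp only [zero_mul, add_zero]
    linarith
  · have hq : 0 < q := lt_of_le_of_ne hq fun h' => hp.ne' (h h'.symm)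
    have h1 := Real.log_le_sub_one_of_pos (show 0 < q * w / p by positivity)
    rw [Real.log_div (by positivity) hp.ne', Real.log_mul hq.ne' hw.ne'] at h1
    rw [Real.log_div hp.ne' hq.ne']
    have h2 := mul_le_mul_of_nonneg_left h1 hp.le
    have h3 : p * (q * w / p - 1) = q * w - p := by field_simp
    linarith

lemma eq_of_mul_log_div_le {p q w : ℝ} (hp : 0 < p) (hq : 0 < q) (hw : 0 < w)
    (h : p * Real.log (p / q) ≤ p * Real.log w + p - q * w) : q = p / w := by
  by_contra hne
  have h0 : q * w / p ≠ 1 := fun h1 => hne (by field_simp at h1 ⊢; exact h1)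
  have h1 := Real.log_lt_sub_one_of_pos (show 0 < q * w / p by positivity) h0
  rw [Real.log_div (by positivity) hp.ne', Real.log_mul hq.ne' hw.ne'] at h1
  rw [Real.log_div hp.ne' hq.ne'] at h
  have h2 := mul_lt_mul_of_pos_left h1 hp
  have h3 : p * (q * w / p - 1) = q * w - p := by field_simp
  linarith

namespace IsEntropyOptimal

variable {l : S → ℝ} {r lam mu : ℝ} {P Q : Simplex S}

lemma ratio_pos (h : IsEntropyOptimal l r P Q lam mu) (i : S) : 0 < P i / Q i :=
  div_pos (h.center_pos i) (h.interior i)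

lemma sum_mul_add (h : IsEntropyOptimal l r P Q lam mu) (Q' : Simplex S) :
    ∑ i, Q' i * l i + lam * ∑ i, Q' i * (P i / Q i) = mu := by
  rw [Finset.mul_sum, ← Finset.sum_add_distrib]
  calc _ = ∑ i, Q' i * mu := Finset.sum_congr rfl fun i _ => by rw [← h.stationary i]; ring
    _ = mu := by rw [← Finset.sum_mul, simplex_sum, one_mul]

lemma sum_mul_add_self (h : IsEntropyOptimal l r P Q lam mu) :
    ∑ i, Q i * l i + lam = mu := by
  have h1 := h.sum_mul_add Q
  have h2 : ∑ i, Q i * (P i / Q i) = 1 := by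
    rw [← simplex_sum P]
    exact Finset.sum_congr rfl fun i _ => mul_div_cancel₀ _ (h.interior i).ne'
  rwa [h2, mul_one] at h1

/-- Weak duality, with the centre of the ball varying as well. -/
lemma sum_mul_le (h : IsEntropyOptimal l r P Q lam mu) {P' Q' : Simplex S}
    (hPQ : relEntropy P' Q' ≤ (r : EReal)) :
    ∑ i, Q' i * l i ≤ ∑ i, Q i * l i - lam * ∑ i, (P' i - P i) * Real.log (P i / Q i) := by
  obtain ⟨hs, hk⟩ := relEntropy_le_iff.1 hPQ
  have h1 : ∑ i, P' i * Real.log (P i / Q i) + 1 - ∑ i, Q' i * (P i / Q i) ≤ klSum P' Q' := by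
    rw [← simplex_sum P', ← Finset.sum_add_distrib, ← Finset.sum_sub_distrib]
    exact Finset.sum_le_sum fun i _ =>
      mul_log_div_ge (simplex_nonneg P' i) (simplex_nonneg Q' i) (hs i) (h.ratio_pos i)
  have h2 := h.sum_mul_add Q'
  have h3 := h.sum_mul_add_self
  have h4 := h.tight
  rw [klSum] at h4
  simp only [sub_mul, Finset.sum_sub_distrib]
  rw [h4]
  have h5 := mul_le_mul_of_nonneg_left (h1.trans hk) h.lam_pos.le
  linarith

/-- The certified maximizer is the only one. -/
lemma eq_of_le (h : IsEntropyOptimal l r P Q lam mu) {Q' : Simplex S}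
    (hPQ : relEntropy P Q' ≤ (r : EReal)) (hle : ∑ i, Q i * l i ≤ ∑ i, Q' i * l i) : Q' = Q := by
  obtain ⟨hs, hk⟩ := relEntropy_le_iff.1 hPQ
  have hle1 : ∀ i ∈ Finset.univ, P i * Real.log (P i / Q i) + P i - Q' i * (P i / Q i)
      ≤ P i * Real.log (P i / Q' i) := fun i _ =>
    mul_log_div_ge (simplex_nonneg P i) (simplex_nonneg Q' i) (hs i) (h.ratio_pos i)
  have h2 := h.sum_mul_add Q'
  have h3 := h.sum_mul_add_self
  have h4 := h.tight
  have hlam := h.lam_pos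
  have h5 : ∑ i, Q' i * (P i / Q i) ≤ 1 := by
    have : lam * ∑ i, Q' i * (P i / Q i) ≤ lam * 1 := by linarith
    exact le_of_mul_le_mul_left this hlam
  have heq : ∑ i, (P i * Real.log (P i / Q i) + P i - Q' i * (P i / Q i))
      = ∑ i, P i * Real.log (P i / Q' i) := by
    refine le_antisymm (Finset.sum_le_sum hle1) ?_
    rw [Finset.sum_sub_distrib, Finset.sum_add_distrib, simplex_sum]
    rw [klSum] at h4 hk
    linarith
  refine simplex_ext fun i => ?_
  have hq : 0 < Q' i := lt_of_le_of_ne (simplex_nonneg Q' i) fun hq =>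
    (h.center_pos i).ne' (hs i hq.symm)
  have := eq_of_mul_log_div_le (h.center_pos i) hq (h.ratio_pos i)
    ((Finset.sum_eq_sum_iff_of_le hle1).1 heq i (Finset.mem_univ i)).ge
  rw [this, div_div_cancel₀ (h.center_pos i).ne']

/-- Two coordinates on which the objective differs determine the multiplier `lam`. -/
lemma lam_eq (h : IsEntropyOptimal l r P Q lam mu) {i j : S} (hij : l i ≠ l j) :
    lam = (l j - l i) / (P i / Q i - P j / Q j) := by
  have h1 : lam * (P i / Q i - P j / Q j) = l j - l i := by
    have := h.stationary i
    have := h.stationary j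
    linarith
  have h2 : P i / Q i - P j / Q j ≠ 0 := fun h0 => by
    rw [h0, mul_zero] at h1
    exact hij (sub_eq_zero.1 h1.symm).symm
  rw [← h1, mul_div_cancel_right₀ _ h2]

end IsEntropyOptimal

end KKT

/-! ### Supergradients along the simplex -/

section Supergradient

variable {S : Type*} [Fintype S]

/-- `g` is a supergradient of `f` at `P` along the simplex, normalized to sum to zero. -/
structure IsSupergradient (f : Simplex S → ℝ) (g : S → ℝ) (P : Simplex S) : Prop where
  sum_eq_zero : ∑ i, g i = 0
  le : ∀ P', f P' ≤ f P + ∑ i, g i * (P' i - P i)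

/-- The projection of a vector to the hyperplane of vectors summing to zero. -/
noncomputable def center (h : S → ℝ) : S → ℝ := fun i => h i - (∑ j, h j) / Fintype.card S

lemma sum_center [Nonempty S] (h : S → ℝ) : ∑ i, center h i = 0 := by
  have : (Fintype.card S : ℝ) ≠ 0 := by exact_mod_cast Fintype.card_ne_zero
  simp only [center, Finset.sum_sub_distrib, Finset.sum_const, Finset.card_univ, nsmul_eq_mul]
  field_simp
  ring

lemma sum_center_mul_sub (h : S → ℝ) (P P' : Simplex S) :
    ∑ i, center h i * (P' i - P i) = ∑ i, h i * (P' i - P i) := by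
  simp only [center, sub_mul, Finset.sum_sub_distrib]
  rw [← Finset.mul_sum, Finset.sum_sub_distrib, simplex_sum, simplex_sum, sub_self, mul_zero,
    sub_zero]

lemma continuous_center : Continuous (center : (S → ℝ) → S → ℝ) := by
  unfold center
  fun_prop

/-- A continuous selection of supergradients consists of gradients. -/
lemma hasSimplexGradientAt_of_isSupergradient {f : Simplex S → ℝ} {g : Simplex S → S → ℝ}
    (hg : ∀ P ∈ simplexInterior S, IsSupergradient f (g P) P) {P : Simplex S}
    (hP : P ∈ simplexInterior S) (hc : ContinuousAt g P) : HasSimplexGradientAt f (g P) P := by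
  refine ⟨(hg P hP).sum_eq_zero, Asymptotics.isLittleO_iff.2 fun ε hε => ?_⟩
  have hpos : 0 < ε / (Fintype.card S + 1) := by positivity
  filter_upwards [isOpen_simplexInterior.mem_nhds hP, Metric.tendsto_nhds.1 hc _ hpos]
    with Q hQ hd
  have h1 := (hg P hP).le Q
  have h2 := (hg Q hQ).le P
  have h3 : ∑ i, g Q i * (P i - Q i) = -∑ i, g Q i * (Q i - P i) := by
    rw [← Finset.sum_neg_distrib]
    exact Finset.sum_congr rfl fun i _ => by ring
  rw [h3] at h2
  have h4 : |∑ i, (g Q i - g P i) * (Q i - P i)| ≤ ε * ‖fun i => Q i - P i‖ := by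
    refine (Finset.abs_sum_le_sum_abs _ _).trans ?_
    calc ∑ i, |(g Q i - g P i) * (Q i - P i)|
        ≤ ∑ _i : S, ε / (Fintype.card S + 1) * ‖fun i => Q i - P i‖ := by
          refine Finset.sum_le_sum fun i _ => ?_
          rw [abs_mul]
          refine mul_le_mul ?_ (norm_le_pi_norm (fun i => Q i - P i) i) (abs_nonneg _) hpos.le
          exact ((dist_le_pi_dist (g Q) (g P) i).trans hd.le)
      _ = Fintype.card S / (Fintype.card S + 1) * (ε * ‖fun i => Q i - P i‖) := by
          rw [Finset.sum_const, Finset.card_univ, nsmul_eq_mul]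
          ring
      _ ≤ 1 * (ε * ‖fun i => Q i - P i‖) := by
          refine mul_le_mul_of_nonneg_right ?_ (by positivity)
          rw [div_le_one (by positivity)]
          linarith
      _ = _ := one_mul _
  simp only [sub_mul, Finset.sum_sub_distrib] at h4
  rw [Real.norm_eq_abs, abs_le]
  have := abs_le.1 h4
  constructor <;> linarith

/-- Supergradients at `P` are bounded by the oscillation of the function divided by the distance
from `P` to the boundary of the simplex. -/
lemma IsSupergradient.norm_le {f : Simplex S → ℝ} {g : S → ℝ} {P : Simplex S}
    (hg : IsSupergradient f g P) {δ c e : ℝ} (hδ : 0 < δ) (hP : ∀ i, δ ≤ P i)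
    (hf : ∀ P', |f P' - c| ≤ e) : ‖g‖ ≤ 2 * e / δ := by
  classical
  have := nonempty_of_simplex P
  have he : 0 ≤ e := (abs_nonneg _).trans (hf P)
  have key : ∀ i j, g i - g j ≤ 2 * e / δ := by
    intro i j
    rcases eq_or_ne i j with rfl | hij
    · rw [sub_self]; positivity
    -- moving mass `δ` from `i` to `j`
    let P' : Simplex S := ⟨fun k => P k - (if k = i then δ else 0) + (if k = j then δ else 0), by
      refine ⟨fun k => ?_, ?_⟩
      · have h1 := hP k
        dsimp only
        split_ifs <;> linarith
      · simp [Finset.sum_add_distrib]⟩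
    have hP' : ∀ k, P' k - P k = (if k = j then δ else 0) - (if k = i then δ else 0) := fun k => by
      change P k - (if k = i then δ else 0) + (if k = j then δ else 0) - P k = _
      ring
    have h1 := hg.le P'
    simp only [hP', mul_sub, Finset.sum_sub_distrib, mul_ite, mul_zero, Finset.sum_ite_eq',
      Finset.mem_univ, if_true] at h1
    have h2 := abs_le.1 (hf P')
    have h3 := abs_le.1 (hf P)
    rw [le_div_iff₀ hδ]
    linarith
  have hn : (0 : ℝ) < Fintype.card S := by exact_mod_cast Fintype.card_pos
  have hup : ∀ i, |g i| ≤ 2 * e / δ := by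
    intro i
    have h1 : ∑ j, (g i - g j) = Fintype.card S * g i := by
      rw [Finset.sum_sub_distrib, hg.sum_eq_zero, Finset.sum_const, Finset.card_univ,
        nsmul_eq_mul, sub_zero]
    have h2 : |∑ j, (g i - g j)| ≤ ∑ _j : S, 2 * e / δ :=
      (Finset.abs_sum_le_sum_abs _ _).trans (Finset.sum_le_sum fun j _ =>
        abs_le.2 ⟨by linarith [key j i], key i j⟩)
    rw [h1, abs_mul, abs_of_pos hn, Finset.sum_const, Finset.card_univ, nsmul_eq_mul] at h2
    exact le_of_mul_le_mul_left h2 hn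
  exact (pi_norm_le_iff_of_nonneg (by positivity)).2 hup

end Supergradient

/-! ### The gradient of the Kullback–Leibler predictor -/

section Gradient

variable {X S : Type*} [Fintype S]

lemma IsEntropyOptimal.cost_eq_klPredictor {ℓ : X → S → ℝ} {r : ℝ} {x : X} {P Q : Simplex S}
    {lam mu : ℝ} (h : IsEntropyOptimal (ℓ x) r P Q lam mu) (T : ℕ+) :
    cost ℓ x Q = klPredictor ℓ r x P T := by
  have hQ : relEntropy P Q ≤ (r : EReal) :=
    relEntropy_le_iff.2 ⟨fun i hi => absurd hi (h.interior i).ne', h.tight.le⟩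
  refine le_antisymm (cost_le_klPredictor ℓ x T hQ)
    (csSup_le ⟨_, Q, hQ, rfl⟩ ?_)
  rintro _ ⟨Q', hQ', rfl⟩
  simpa [cost] using h.sum_mul_le hQ'

/-- The vector `-lam log (P i / Q i)` is, up to centering, a supergradient of the predictor. -/
lemma IsEntropyOptimal.isSupergradient {ℓ : X → S → ℝ} {r : ℝ} (hr : 0 < r) {x : X}
    {P Q : Simplex S} {lam mu : ℝ} (h : IsEntropyOptimal (ℓ x) r P Q lam mu) (T : ℕ+) :
    IsSupergradient (fun P => klPredictor ℓ r x P T)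
      (center fun i => -(lam * Real.log (P i / Q i))) P := by
  have := nonempty_of_simplex P
  refine ⟨sum_center _, fun P' => klPredictor_le ℓ hr.le x T fun Q' hQ' => ?_⟩
  rw [sum_center_mul_sub, ← h.cost_eq_klPredictor T]
  refine (h.sum_mul_le hQ').trans_eq ?_
  rw [Finset.mul_sum, sub_eq_add_neg, ← Finset.sum_neg_distrib]
  congr 1
  exact Finset.sum_congr rfl fun i _ => by ring

lemma klPredictor_of_const {ℓ : X → S → ℝ} {r : ℝ} (hr : 0 < r) {x : X} {c : ℝ}
    (h : ∀ i, ℓ x i = c) (P : Simplex S) (T : ℕ+) : klPredictor ℓ r x P T = c := by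
  have := abs_klPredictor_sub_le ℓ hr.le x P T c
  simp only [h, sub_self, abs_zero, Finset.sum_const_zero] at this
  exact sub_eq_zero.1 (abs_eq_zero.1 (le_antisymm this (abs_nonneg _)))

/-- The maximizer depends continuously on the decision and the centre of the ball: it is unique,
the constraint and the optimality condition are closed, and the simplex is compact. -/
lemma tendsto_maximizer [TopologicalSpace X] {ℓ : X → S → ℝ}
    (hℓ : ∀ i, Continuous fun x => ℓ x i) {r : ℝ} (hr : 0 < r) {x₀ : X} {P₀ Q₀ : Simplex S}
    {lam mu : ℝ} (h : IsEntropyOptimal (ℓ x₀) r P₀ Q₀ lam mu)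
    {q : X × Simplex S → Simplex S}
    (hq : ∀ᶠ z in 𝓝 (x₀, P₀), relEntropy z.2 (q z) ≤ (r : EReal) ∧
      klPredictor ℓ r z.1 z.2 1 ≤ cost ℓ z.1 (q z)) :
    Tendsto q (𝓝 (x₀, P₀)) (𝓝 Q₀) := by
  have hcl : IsClosed {w : (X × Simplex S) × Simplex S |
      relEntropy w.1.2 w.2 ≤ (r : EReal) ∧ klPredictor ℓ r w.1.1 w.1.2 1 ≤ cost ℓ w.1.1 w.2} :=
    ((isClosed_setOf_relEntropy_le r).preimage
      (by fun_prop : Continuous fun w : (X × Simplex S) × Simplex S => (w.1.2, w.2))).inter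
      (isClosed_le ((continuous_klPredictor hℓ hr 1).comp continuous_fst)
        ((continuous_cost hℓ).comp
          (by fun_prop : Continuous fun w : (X × Simplex S) × Simplex S => (w.1.1, w.2))))
  refine tendsto_nhds_of_unique_mapClusterPt fun Q₁ hQ₁ => ?_
  have hmem : ((x₀, P₀), Q₁) ∈ {w : (X × Simplex S) × Simplex S |
      relEntropy w.1.2 w.2 ≤ (r : EReal) ∧ klPredictor ℓ r w.1.1 w.1.2 1 ≤ cost ℓ w.1.1 w.2} := by
    obtain ⟨U, hU, hUQ⟩ := mapClusterPt_iff_ultrafilter.1 hQ₁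
    exact hcl.mem_of_tendsto ((tendsto_id'.2 hU).prodMk_nhds hUQ) (hU hq)
  refine h.eq_of_le hmem.1 ?_
  have := hmem.2
  rwa [← h.cost_eq_klPredictor 1] at this

open Classical in
/-- The gradient of the predictor in the distribution.  For a loss that does not depend on the
scenario the predictor is constant and the gradient is zero; otherwise the gradient is read off
from a maximizer and its multiplier. -/
noncomputable def klGradient (ℓ : X → S → ℝ) (r : ℝ) (x : X) (P : Simplex S) : S → ℝ :=
  if h : ∃ w : Simplex S × ℝ × ℝ, IsEntropyOptimal (ℓ x) r P w.1 w.2.1 w.2.2 ∧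
      ∃ i j, ℓ x i ≠ ℓ x j then
    center fun i => -(h.choose.2.1 * Real.log (P i / h.choose.1 i))
  else 0

lemma klGradient_of_const {ℓ : X → S → ℝ} {r : ℝ} {x : X} (h : ∀ i j, ℓ x i = ℓ x j)
    (P : Simplex S) : klGradient ℓ r x P = 0 := by
  refine dif_neg ?_
  rintro ⟨-, -, i, j, hij⟩
  exact hij (h i j)

lemma exists_klGradient_eq {ℓ : X → S → ℝ} {r : ℝ} (hr : 0 < r) {x : X}
    (h : ∃ i j, ℓ x i ≠ ℓ x j) {P : Simplex S} (hP : P ∈ simplexInterior S) :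
    ∃ Q lam mu, IsEntropyOptimal (ℓ x) r P Q lam mu ∧
      klGradient ℓ r x P = center fun i => -(lam * Real.log (P i / Q i)) := by
  obtain ⟨Q, lam, mu, hQ⟩ := exists_isEntropyOptimal h hr hP
  have hex : ∃ w : Simplex S × ℝ × ℝ, IsEntropyOptimal (ℓ x) r P w.1 w.2.1 w.2.2 ∧
      ∃ i j, ℓ x i ≠ ℓ x j := ⟨(Q, lam, mu), hQ, h⟩
  exact ⟨hex.choose.1, hex.choose.2.1, hex.choose.2.2, hex.choose_spec.1, dif_pos hex⟩

lemma isSupergradient_klGradient {ℓ : X → S → ℝ} {r : ℝ} (hr : 0 < r) (x : X) (T : ℕ+)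
    {P : Simplex S} (hP : P ∈ simplexInterior S) :
    IsSupergradient (fun P => klPredictor ℓ r x P T) (klGradient ℓ r x P) P := by
  by_cases h : ∃ i j, ℓ x i ≠ ℓ x j
  · obtain ⟨Q, lam, mu, hQ, he⟩ := exists_klGradient_eq hr h hP
    rw [he]
    exact hQ.isSupergradient hr T
  · push Not at h
    obtain ⟨i₀⟩ := nonempty_of_simplex P
    rw [klGradient_of_const h]
    refine ⟨by simp, fun P' => ?_⟩
    simp [klPredictor_of_const hr (fun i => h i i₀)]

lemma continuousAt_klGradient_of_ne [TopologicalSpace X] {ℓ : X → S → ℝ}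
    (hℓ : ∀ i, Continuous fun x => ℓ x i) {r : ℝ} (hr : 0 < r) {x₀ : X} {P₀ : Simplex S}
    (hP₀ : P₀ ∈ simplexInterior S) {i j : S} (hij : ℓ x₀ i ≠ ℓ x₀ j) :
    ContinuousAt (fun z : X × Simplex S => klGradient ℓ r z.1 z.2) (x₀, P₀) := by
  classical
  have hev : ∀ᶠ z : X × Simplex S in 𝓝 (x₀, P₀),
      z.2 ∈ simplexInterior S ∧ ℓ z.1 i ≠ ℓ z.1 j :=
    (continuous_snd.continuousAt.eventually (isOpen_simplexInterior.mem_nhds hP₀)).and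
      ((isOpen_ne_fun ((hℓ i).comp continuous_fst) ((hℓ j).comp continuous_fst)).mem_nhds hij)
  have hex : ∀ z : X × Simplex S, ∃ Q : Simplex S, z.2 ∈ simplexInterior S ∧ ℓ z.1 i ≠ ℓ z.1 j →
      ∃ lam mu, IsEntropyOptimal (ℓ z.1) r z.2 Q lam mu ∧
        klGradient ℓ r z.1 z.2 = center fun k => -(lam * Real.log (z.2 k / Q k)) := fun z => by
    by_cases hz : z.2 ∈ simplexInterior S ∧ ℓ z.1 i ≠ ℓ z.1 j
    · obtain ⟨Q, lam, mu, h⟩ := exists_klGradient_eq hr ⟨i, j, hz.2⟩ hz.1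
      exact ⟨Q, fun _ => ⟨lam, mu, h⟩⟩
    · exact ⟨P₀, fun h => absurd h hz⟩
  choose q hq using hex
  obtain ⟨lam₀, mu₀, hopt₀, -⟩ := hq (x₀, P₀) hev.self_of_nhds
  have hlim : ContinuousAt q (x₀, P₀) := by
    refine tendsto_maximizer hℓ hr hopt₀ (hev.mono fun z hz => ?_)
    obtain ⟨lam, mu, hopt, -⟩ := hq z hz
    exact ⟨relEntropy_le_iff.2 ⟨fun k hk => absurd hk (hopt.interior k).ne', hopt.tight.le⟩,
      (hopt.cost_eq_klPredictor 1).ge⟩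
  have hform : (fun z : X × Simplex S => klGradient ℓ r z.1 z.2) =ᶠ[𝓝 (x₀, P₀)] fun z =>
      center fun k => -((ℓ z.1 j - ℓ z.1 i) / (z.2 i / q z i - z.2 j / q z j)
        * Real.log (z.2 k / q z k)) := hev.mono fun z hz => by
    obtain ⟨lam, mu, hopt, he⟩ := hq z hz
    dsimp only
    rw [← hopt.lam_eq hz.2]
    exact he
  refine ContinuousAt.congr ?_ hform.symm
  have hratio : ∀ k, ContinuousAt (fun z : X × Simplex S => z.2 k / q z k) (x₀, P₀) := fun k =>
    (((continuous_simplex_apply k).comp continuous_snd).continuousAt).div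
      ((continuous_simplex_apply k).continuousAt.comp hlim) (hopt₀.interior k).ne'
  refine continuous_center.continuousAt.comp (continuousAt_pi.2 fun k => ?_)
  refine ((ContinuousAt.div ?_ ((hratio i).sub (hratio j)) fun h0 => ?_).mul
    ((hratio k).log (hopt₀.ratio_pos k).ne')).neg
  · exact (((hℓ j).comp continuous_fst).sub ((hℓ i).comp continuous_fst)).continuousAt
  · have := hopt₀.lam_eq hij
    have hl := hopt₀.lam_pos
    rw [Pi.sub_apply] at h0
    dsimp only at h0 this hl
    rw [h0, div_zero] at this
    exact hl.ne' this

/-- Near a decision whose loss does not depend on the scenario, the gradient is small because the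
oscillation of the predictor is. -/
lemma continuousAt_klGradient_of_const [TopologicalSpace X] {ℓ : X → S → ℝ}
    (hℓ : ∀ i, Continuous fun x => ℓ x i) {r : ℝ} (hr : 0 < r) {x₀ : X} {P₀ : Simplex S}
    (hP₀ : P₀ ∈ simplexInterior S) (h : ∀ i j, ℓ x₀ i = ℓ x₀ j) :
    ContinuousAt (fun z : X × Simplex S => klGradient ℓ r z.1 z.2) (x₀, P₀) := by
  obtain ⟨i₀⟩ := nonempty_of_simplex P₀
  have : Nonempty S := ⟨i₀⟩
  obtain ⟨m, hm⟩ := Finite.exists_min fun i => P₀ i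
  set δ := P₀ m / 2 with hδ
  have hδ0 : 0 < δ := half_pos (hP₀ m)
  have hev : ∀ᶠ z : X × Simplex S in 𝓝 (x₀, P₀), ∀ i, δ ≤ z.2 i := by
    refine eventually_all.2 fun i => ?_
    have : δ < P₀ i := (half_lt_self (hP₀ m)).trans_le (hm i)
    exact (((continuous_simplex_apply i).comp continuous_snd).continuousAt.eventually
      (lt_mem_nhds this)).mono fun z hz => le_of_lt hz
  have hbound : Tendsto (fun z : X × Simplex S => 2 * (∑ i, |ℓ z.1 i - ℓ x₀ i₀|) / δ)
      (𝓝 (x₀, P₀)) (𝓝 0) := by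
    have hc : Continuous (fun z : X × Simplex S => 2 * (∑ i, |ℓ z.1 i - ℓ x₀ i₀|) / δ) :=
      (continuous_const.mul (continuous_finsetSum _ fun i _ =>
        (((hℓ i).comp continuous_fst).sub continuous_const).abs)).div_const _
    have h0 := hc.tendsto (x₀, P₀)
    have hz : ∀ i, ℓ x₀ i - ℓ x₀ i₀ = 0 := fun i => sub_eq_zero.2 (h i i₀)
    simpa [hz] using h0
  unfold ContinuousAt
  dsimp only
  rw [klGradient_of_const h]
  refine squeeze_zero_norm' (hev.mono fun z hz => ?_) hbound
  exact (isSupergradient_klGradient hr z.1 1 fun i => hδ0.trans_le (hz i)).norm_le hδ0 hz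
    fun P' => abs_klPredictor_sub_le ℓ hr.le z.1 P' 1 _

lemma continuousAt_klGradient [TopologicalSpace X] {ℓ : X → S → ℝ}
    (hℓ : ∀ i, Continuous fun x => ℓ x i) {r : ℝ} (hr : 0 < r) (x₀ : X) {P₀ : Simplex S}
    (hP₀ : P₀ ∈ simplexInterior S) :
    ContinuousAt (fun z : X × Simplex S => klGradient ℓ r z.1 z.2) (x₀, P₀) := by
  by_cases h : ∃ i j, ℓ x₀ i ≠ ℓ x₀ j
  · obtain ⟨i, j, hij⟩ := h
    exact continuousAt_klGradient_of_ne hℓ hr hP₀ hij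
  · push Not at h
    exact continuousAt_klGradient_of_const hℓ hr hP₀ h

theorem isRegularPredictor_klPredictor [TopologicalSpace X] [CompactSpace X] {ℓ : X → S → ℝ}
    (hℓ : ∀ i, Continuous fun x => ℓ x i) {r : ℝ} (hr : 0 < r) :
    IsRegularPredictor (klPredictor ℓ r) := by
  refine ⟨isBoundedEquicontinuous_klPredictor hℓ hr, fun _ => klGradient ℓ r,
    fun T x P hP => ?_, fun C hC hCi => ?_, fun z hz U hU => ?_⟩
  · refine hasSimplexGradientAt_of_isSupergradient
      (fun P hP => isSupergradient_klGradient hr x T hP) hP ?_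
    exact (continuousAt_klGradient hℓ hr x hP).comp
      (by fun_prop : Continuous fun P : Simplex S => (x, P)).continuousAt
  · have hcont : ContinuousOn (fun z : X × Simplex S => klGradient ℓ r z.1 z.2)
        (Set.univ ×ˢ C) := fun z hz =>
      (continuousAt_klGradient hℓ hr z.1 (hCi hz.2)).continuousWithinAt
    obtain ⟨B, hB⟩ := (isCompact_univ.prod hC).exists_bound_of_continuousOn hcont
    exact ⟨B, fun _ x P hP => hB (x, P) ⟨Set.mem_univ x, hP⟩⟩
  · filter_upwards [nhdsWithin_le_nhds ((continuousAt_klGradient hℓ hr z.1 hz.2)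
      (UniformSpace.ball_mem_nhds _ hU))] with w hw T
    exact hw

end Gradient

/-! ### Words and their types -/

/-- The periodic continuation of a word of length `T`. -/
def periodize {S : Type*} (T : ℕ+) (s : Fin T → S) : ℕ → S := fun n => s ⟨n % T, Nat.mod_lt _ T.pos⟩

lemma periodize_apply {S : Type*} (T : ℕ+) (s : Fin T → S) (t : Fin T) : periodize T s t = s t := by
  unfold periodize
  congr 1
  exact Fin.ext (Nat.mod_eq_of_lt t.2)

/-- The sequences that begin with a given word. -/
def cylinderOf {S : Type*} {T : ℕ+} (s : Fin T → S) : Set (ℕ → S) := {ω | ∀ t : Fin T, ω t = s t}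

section Words

variable {S : Type*} [Fintype S]

open Classical in
lemma mul_empirical_apply (T : ℕ+) (ω : ℕ → S) (i : S) :
    (T : ℝ) * empirical T ω i = ∑ t ∈ Finset.range T, if ω t = i then (1 : ℝ) else 0 := by
  have hT : ((T : ℕ) : ℝ) ≠ 0 := by exact_mod_cast T.ne_zero
  change ((T : ℕ) : ℝ) *
    ((((Finset.range T).filter (fun t => ω t = i)).card : ℝ) / (T : ℕ)) = _
  rw [mul_div_cancel₀ _ hT, Finset.card_filter]
  push_cast
  rfl

lemma sum_range_eq_empirical (T : ℕ+) (ω : ℕ → S) (h : S → ℝ) :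
    ∑ t ∈ Finset.range T, h (ω t) = T * ∑ i, empirical T ω i * h i := by
  classical
  rw [Finset.mul_sum]
  simp_rw [← mul_assoc, mul_empirical_apply, Finset.sum_mul]
  rw [Finset.sum_comm]
  exact Finset.sum_congr rfl fun t _ => by simp

lemma empirical_congr (T : ℕ+) {ω ω' : ℕ → S} (h : ∀ t < (T : ℕ), ω t = ω' t) :
    empirical T ω = empirical T ω' := by
  classical
  have hT : ((T : ℕ) : ℝ) ≠ 0 := by exact_mod_cast T.ne_zero
  refine simplex_ext fun i => mul_left_cancel₀ hT ?_
  rw [mul_empirical_apply, mul_empirical_apply]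
  exact Finset.sum_congr rfl fun t ht => by rw [h t (Finset.mem_range.1 ht)]

/-- The type of a word: the frequencies of its letters.  Encoding it as the empirical distribution of
the periodic continuation makes it a point of the simplex without further proof. -/
noncomputable def wordType (T : ℕ+) (s : Fin T → S) : Simplex S := empirical T (periodize T s)

lemma empirical_eq_wordType (T : ℕ+) (ω : ℕ → S) :
    empirical T ω = wordType T fun t => ω t :=
  empirical_congr T fun t ht => (periodize_apply T (fun t : Fin T => ω t) ⟨t, ht⟩).symm

lemma sum_word_eq (T : ℕ+) (s : Fin T → S) (h : S → ℝ) :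
    ∑ t, h (s t) = T * ∑ i, wordType T s i * h i := by
  rw [wordType, ← sum_range_eq_empirical, Finset.sum_range]
  simp only [periodize_apply]

lemma wordType_pos (T : ℕ+) (s : Fin T → S) (t : Fin T) : 0 < wordType T s (s t) := by
  classical
  have h := sum_word_eq T s fun i => if i = s t then 1 else 0
  simp only [mul_ite, mul_one, mul_zero, Finset.sum_ite_eq', Finset.mem_univ, if_true] at h
  have h1 : (1 : ℝ) ≤ ∑ t', if s t' = s t then (1 : ℝ) else 0 := by
    have := Finset.single_le_sum (f := fun t' => if s t' = s t then (1 : ℝ) else 0)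
      (fun t' _ => by split_ifs <;> norm_num) (Finset.mem_univ t)
    simpa using this
  have hT : (0 : ℝ) < (T : ℕ) := by exact_mod_cast T.pos
  rw [h] at h1
  exact pos_of_mul_pos_right (by linarith) hT.le

lemma exists_eq_of_wordType_ne_zero (T : ℕ+) (s : Fin T → S) {i : S} (h : wordType T s i ≠ 0) :
    ∃ t, s t = i := by
  classical
  by_contra hne
  push Not at hne
  have h1 := sum_word_eq T s fun j => if j = i then 1 else 0
  simp [hne] at h1
  exact h h1

/-- The probability of a word under i.i.d. sampling from `P`. -/
noncomputable def wordProb (P : Simplex S) {T : ℕ+} (s : Fin T → S) : ℝ := ∏ t, P (s t)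

lemma wordProb_nonneg (P : Simplex S) {T : ℕ+} (s : Fin T → S) : 0 ≤ wordProb P s :=
  Finset.prod_nonneg fun _ _ => simplex_nonneg P _

lemma sum_wordProb (P : Simplex S) (T : ℕ+) : ∑ s : Fin T → S, wordProb P s = 1 := by
  classical
  have := Finset.sum_pow' Finset.univ (fun i => P i) (T : ℕ)
  rw [simplex_sum, one_pow, Fintype.piFinset_univ] at this
  exact this.symm

/-- Change of measure: the likelihood ratio of a word depends on its type only. -/
lemma wordProb_eq_exp_mul {P Q : Simplex S} {T : ℕ+} (s : Fin T → S) (hP : ∀ t, 0 < P (s t))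
    (hQ : ∀ t, 0 < Q (s t)) :
    wordProb Q s
      = Real.exp (-(T * ∑ i, wordType T s i * Real.log (P i / Q i))) * wordProb P s := by
  rw [← sum_word_eq T s fun i => Real.log (P i / Q i), ← Finset.sum_neg_distrib, Real.exp_sum,
    wordProb, wordProb, ← Finset.prod_mul_distrib]
  refine Finset.prod_congr rfl fun t _ => ?_
  rw [← Real.log_inv, Real.exp_log (inv_pos.2 (div_pos (hP t) (hQ t))), inv_div,
    div_mul_cancel₀ _ (hP t).ne']

/-- A word whose type is at relative entropy more than `r` from `P` is by a factor `exp (-r T)`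
less likely under `P` than under its own type. -/
lemma wordProb_le_of_lt_relEntropy {P : Simplex S} {T : ℕ+} (s : Fin T → S) {r : ℝ}
    (h : ¬ relEntropy (wordType T s) P ≤ (r : EReal)) :
    wordProb P s ≤ Real.exp (-(r * T)) * wordProb (wordType T s) s := by
  by_cases hs : ∀ t, 0 < P (s t)
  · have hsupp : ∀ i, P i = 0 → wordType T s i = 0 := by
      intro i hi
      by_contra hne
      obtain ⟨t, rfl⟩ := exists_eq_of_wordType_ne_zero T s hne
      exact (hs t).ne' hi
    rw [relEntropy_le_iff, not_and] at h
    have h1 := not_le.1 (h hsupp)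
    rw [wordProb_eq_exp_mul (P := wordType T s) (Q := P) s (wordType_pos T s) hs]
    refine mul_le_mul_of_nonneg_right (Real.exp_le_exp.2 (neg_le_neg ?_)) (wordProb_nonneg _ _)
    rw [mul_comm]
    exact mul_le_mul_of_nonneg_left h1.le (by positivity)
  · push Not at hs
    obtain ⟨t, ht⟩ := hs
    have h0 : wordProb P s = 0 :=
      Finset.prod_eq_zero (Finset.mem_univ t) (le_antisymm ht (simplex_nonneg P _))
    rw [h0]
    exact mul_nonneg (Real.exp_pos _).le (wordProb_nonneg _ _)

open Classical in
/-- There are only polynomially many types. -/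
lemma card_wordTypes_le (T : ℕ+) :
    (Finset.univ.image (wordType (S := S) T)).card ≤ ((T : ℕ) + 1) ^ Fintype.card S := by
  have hT : ((T : ℕ) : ℝ) ≠ 0 := by exact_mod_cast T.ne_zero
  have hcount : ∀ s i, ∃ n ≤ (T : ℕ), (T : ℝ) * wordType (S := S) T s i = n := fun s i => by
    refine ⟨((Finset.range T).filter fun t => periodize T s t = i).card,
      (Finset.card_filter_le _ _).trans (by simp), ?_⟩
    rw [wordType, mul_empirical_apply, Finset.sum_boole]
  -- a type is determined by its letter counts, integers between `0` and `T`
  refine (Finset.card_le_card_of_injOn (fun R i => ⌊(T : ℝ) * R i⌋₊)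
    (t := Fintype.piFinset fun _ => Finset.range ((T : ℕ) + 1)) ?_ ?_).trans_eq (by simp)
  · intro R hR
    obtain ⟨s, -, rfl⟩ := Finset.mem_image.1 (Finset.mem_coe.1 hR)
    refine Finset.mem_coe.2 (Fintype.mem_piFinset.2 fun i => ?_)
    obtain ⟨n, hn, he⟩ := hcount s i
    dsimp only
    rw [he, Nat.floor_natCast, Finset.mem_range]
    exact Nat.lt_succ_of_le hn
  · intro R hR R' hR' h
    obtain ⟨s, -, rfl⟩ := Finset.mem_image.1 (Finset.mem_coe.1 hR)
    obtain ⟨s', -, rfl⟩ := Finset.mem_image.1 (Finset.mem_coe.1 hR')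
    refine simplex_ext fun i => mul_left_cancel₀ hT ?_
    obtain ⟨n, -, he⟩ := hcount s i
    obtain ⟨n', -, he'⟩ := hcount s' i
    have hi : ⌊(T : ℝ) * wordType T s i⌋₊ = ⌊(T : ℝ) * wordType T s' i⌋₊ := congrFun h i
    rw [he, he', Nat.floor_natCast, Nat.floor_natCast] at hi
    rw [he, he', hi]

open Classical in
/-- The upper bound of Sanov's theorem for the complement of an entropy ball. -/
lemma sum_wordProb_lt_relEntropy_le (P : Simplex S) (T : ℕ+) (r : ℝ) :
    ∑ s : Fin T → S with ¬ relEntropy (wordType T s) P ≤ (r : EReal), wordProb P s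
      ≤ ((T : ℕ) + 1 : ℝ) ^ Fintype.card S * Real.exp (-(r * T)) := by
  calc ∑ s : Fin T → S with ¬ relEntropy (wordType T s) P ≤ (r : EReal), wordProb P s
      ≤ ∑ s : Fin T → S with ¬ relEntropy (wordType T s) P ≤ (r : EReal),
          Real.exp (-(r * T)) * wordProb (wordType T s) s :=
        Finset.sum_le_sum fun s hs => wordProb_le_of_lt_relEntropy s (Finset.mem_filter.1 hs).2
    _ ≤ ∑ s : Fin T → S, Real.exp (-(r * T)) * wordProb (wordType T s) s :=
        Finset.sum_le_sum_of_subset_of_nonneg (Finset.filter_subset _ _) fun s _ _ =>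
          mul_nonneg (Real.exp_pos _).le (wordProb_nonneg _ _)
    _ ≤ ∑ s : Fin T → S, ∑ R ∈ Finset.univ.image (wordType (S := S) T),
          Real.exp (-(r * T)) * wordProb R s := by
        refine Finset.sum_le_sum fun s _ => ?_
        exact Finset.single_le_sum (f := fun R => Real.exp (-(r * T)) * wordProb R s)
          (fun R _ => mul_nonneg (Real.exp_pos _).le (wordProb_nonneg _ _))
          (Finset.mem_image_of_mem _ (Finset.mem_univ s))
    _ = (Finset.univ.image (wordType (S := S) T)).card * Real.exp (-(r * T)) := by
        rw [Finset.sum_comm]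
        simp only [← Finset.mul_sum, sum_wordProb, mul_one]
        rw [Finset.sum_const, nsmul_eq_mul]
    _ ≤ _ := by
        refine mul_le_mul_of_nonneg_right ?_ (Real.exp_pos _).le
        exact_mod_cast card_wordTypes_le T

open Classical in
lemma setOf_empirical_mem_eq (T : ℕ+) (A : Set (Simplex S)) :
    {ω : ℕ → S | empirical T ω ∈ A}
      = ⋃ s ∈ (Finset.univ.filter fun s : Fin T → S => wordType T s ∈ A), cylinderOf s := by
  ext ω
  simp only [Set.mem_ofPred_eq, Set.mem_iUnion, Finset.mem_filter, Finset.mem_univ, true_and,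
    cylinderOf, exists_prop]
  constructor
  · exact fun h => ⟨fun t => ω t, by rwa [← empirical_eq_wordType], fun _ => rfl⟩
  · rintro ⟨s, hs, h⟩
    rw [empirical_eq_wordType, show (fun t : Fin T => ω t) = s from funext h]
    exact hs

end Words

/-! ### The law of the empirical distribution -/

section Law

variable {S : Type*} [Fintype S] [MeasurableSpace S] [DiscreteMeasurableSpace S]

lemma simplexMeasure_singleton (P : Simplex S) (i : S) :
    simplexMeasure P {i} = ENNReal.ofReal (P i) := by
  classical
  simp [simplexMeasure, Set.indicator_apply]

instance sampleMeasure_isProbabilityMeasure (P : Simplex S) :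
    IsProbabilityMeasure (sampleMeasure P) := by
  unfold sampleMeasure
  infer_instance

lemma measurableSet_cylinderOf {T : ℕ+} (s : Fin T → S) : MeasurableSet (cylinderOf s) := by
  have : cylinderOf s = ⋂ t : Fin T, (fun ω : ℕ → S => ω t) ⁻¹' {s t} := by
    ext ω; simp [cylinderOf]
  rw [this]
  exact MeasurableSet.iInter fun t => measurable_pi_apply _ (measurableSet_singleton _)

lemma sampleMeasure_cylinderOf (P : Simplex S) {T : ℕ+} (s : Fin T → S) :
    sampleMeasure P (cylinderOf s) = ENNReal.ofReal (wordProb P s) := by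
  have : cylinderOf s = Set.pi (Finset.range T) fun n => {periodize T s n} := by
    ext ω
    simp only [cylinderOf, Set.mem_pi, Finset.coe_range, Set.mem_Iio, Set.mem_singleton_iff]
    constructor
    · exact fun h n hn => (h ⟨n, hn⟩).trans (periodize_apply T s ⟨n, hn⟩).symm
    · exact fun h t => (h t t.2).trans (periodize_apply T s t)
  rw [this, sampleMeasure, Measure.infinitePi_pi _ fun _ _ => measurableSet_singleton _]
  simp_rw [simplexMeasure_singleton]
  rw [← ENNReal.ofReal_prod_of_nonneg fun _ _ => simplex_nonneg P _, Finset.prod_range]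
  simp only [periodize_apply, wordProb]

lemma measurableSet_setOf_empirical_mem (T : ℕ+) (A : Set (Simplex S)) :
    MeasurableSet {ω : ℕ → S | empirical T ω ∈ A} := by
  classical
  rw [setOf_empirical_mem_eq]
  exact Finset.measurableSet_biUnion _ fun s _ => measurableSet_cylinderOf s

open Classical in
lemma sampleMeasure_empirical_mem (P : Simplex S) (T : ℕ+) (A : Set (Simplex S)) :
    sampleMeasure P {ω | empirical T ω ∈ A}
      = ENNReal.ofReal (∑ s : Fin T → S with wordType T s ∈ A, wordProb P s) := by
  rw [setOf_empirical_mem_eq, measure_biUnion_finset ?_ fun s _ => measurableSet_cylinderOf s,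
    ENNReal.ofReal_sum_of_nonneg fun s _ => wordProb_nonneg P s]
  · simp_rw [sampleMeasure_cylinderOf]
  · intro s _ s' _ hne
    refine Set.disjoint_left.2 fun ω h h' => hne (funext fun t => ?_)
    exact (h t).symm.trans (h' t)

/-- Sanov's upper bound for the empirical distribution. -/
lemma sampleMeasure_lt_relEntropy_le (P : Simplex S) (T : ℕ+) (r : ℝ) :
    sampleMeasure P {ω | ¬ relEntropy (empirical T ω) P ≤ (r : EReal)}
      ≤ ENNReal.ofReal (((T : ℕ) + 1 : ℝ) ^ Fintype.card S * Real.exp (-(r * T))) := by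
  classical
  have h := sampleMeasure_empirical_mem P T {R | ¬ relEntropy R P ≤ (r : EReal)}
  refine h.trans_le (ENNReal.ofReal_le_ofReal ?_)
  convert sum_wordProb_lt_relEntropy_le P T r

/-- Change of measure on an event on which the exponent of the likelihood ratio is bounded. -/
lemma sampleMeasure_change {P Q : Simplex S} (hP : P ∈ simplexInterior S)
    (hQ : Q ∈ simplexInterior S) (T : ℕ+) {b : ℝ} {A : Set (Simplex S)}
    (hA : ∀ R ∈ A, ∑ i, R i * Real.log (P i / Q i) ≤ b) :
    ENNReal.ofReal (Real.exp (-(b * T))) * sampleMeasure P {ω | empirical T ω ∈ A}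
      ≤ sampleMeasure Q {ω | empirical T ω ∈ A} := by
  classical
  rw [sampleMeasure_empirical_mem, sampleMeasure_empirical_mem,
    ← ENNReal.ofReal_mul (Real.exp_pos _).le, Finset.mul_sum]
  refine ENNReal.ofReal_le_ofReal (Finset.sum_le_sum fun s hs => ?_)
  rw [wordProb_eq_exp_mul (P := P) (Q := Q) s (fun t => hP _) fun t => hQ _]
  refine mul_le_mul_of_nonneg_right (Real.exp_le_exp.2 (neg_le_neg ?_)) (wordProb_nonneg _ _)
  rw [mul_comm]
  exact mul_le_mul_of_nonneg_right (hA _ (Finset.mem_filter.1 hs).2) (by positivity)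

/-- The strong law of large numbers for the empirical distribution. -/
lemma ae_tendsto_empirical (P : Simplex S) :
    ∀ᵐ ω ∂sampleMeasure P, Tendsto (fun T : ℕ+ => empirical T ω) atTop (𝓝 P) := by
  classical
  have key : ∀ i, ∀ᵐ ω ∂sampleMeasure P,
      Tendsto (fun T : ℕ+ => empirical T ω i) atTop (𝓝 (P i)) := by
    intro i
    let h : S → ℝ := fun j => if j = i then 1 else 0
    have hm : Measurable h := measurable_of_countable h
    have hmX : ∀ n : ℕ, Measurable fun ω : ℕ → S => h (ω n) := fun n =>
      hm.comp (measurable_pi_apply n)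
    have hmap : ∀ n : ℕ, (sampleMeasure P).map (fun ω => ω n) = simplexMeasure P := fun n =>
      Measure.infinitePi_map_eval _ n
    have hind : ProbabilityTheory.iIndepFun (fun (n : ℕ) (ω : ℕ → S) => h (ω n)) (sampleMeasure P) :=
      ProbabilityTheory.iIndepFun_infinitePi (X := fun _ => h) fun _ => hm
    have hident : ∀ n : ℕ, ProbabilityTheory.IdentDistrib (fun ω : ℕ → S => h (ω n))
        (fun ω => h (ω 0)) (sampleMeasure P) (sampleMeasure P) := fun n =>
      (ProbabilityTheory.IdentDistrib.mk (measurable_pi_apply n).aemeasurable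
        (measurable_pi_apply 0).aemeasurable ((hmap n).trans (hmap 0).symm)).comp hm
    have hint : Integrable (fun ω : ℕ → S => h (ω 0)) (sampleMeasure P) := by
      refine Integrable.of_bound (hmX 0).aestronglyMeasurable 1 (Eventually.of_forall fun ω => ?_)
      simp only [h]
      split_ifs <;> simp
    have hexp : ∫ ω, h (ω 0) ∂sampleMeasure P = P i := by
      have : (fun ω : ℕ → S => h (ω 0)) = ((fun ω : ℕ → S => ω 0) ⁻¹' {i}).indicator 1 := by
        funext ω
        simp [h, Set.indicator_apply]
      rw [this, integral_indicator_one (measurable_pi_apply 0 (measurableSet_singleton i)),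
        measureReal_def, ← Measure.map_apply (measurable_pi_apply 0) (measurableSet_singleton i),
        hmap, simplexMeasure_singleton, ENNReal.toReal_ofReal (simplex_nonneg P i)]
    have hslln := ProbabilityTheory.strong_law_ae_real (fun (n : ℕ) (ω : ℕ → S) => h (ω n)) hint
      (fun m n hmn => hind.indepFun hmn) hident
    rw [hexp] at hslln
    filter_upwards [hslln] with ω hω
    have hcomp := hω.comp tendsto_PNat_val_atTop_atTop
    refine hcomp.congr fun T => ?_
    have hT : ((T : ℕ) : ℝ) ≠ 0 := by exact_mod_cast T.ne_zero
    simp only [Function.comp_apply]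
    rw [div_eq_iff hT, mul_comm]
    exact (mul_empirical_apply T ω i).symm
  filter_upwards [ae_all_iff.2 key] with ω hω
  exact tendsto_subtype_rng.2 (tendsto_pi_nhds.2 hω)

lemma tendsto_sampleMeasure_empirical_mem {P : Simplex S} {U : Set (Simplex S)} (hU : U ∈ 𝓝 P) :
    Tendsto (fun T : ℕ+ => sampleMeasure P {ω | empirical T ω ∈ U}) atTop (𝓝 1) := by
  have h := tendsto_measure_of_ae_tendsto_indicator_of_isFiniteMeasure (atTop : Filter ℕ+)
    (μ := sampleMeasure P) (A := Set.univ) (As := fun T => {ω | empirical T ω ∈ U})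
    MeasurableSet.univ (fun T => measurableSet_setOf_empirical_mem T U) ?_
  · simpa using h
  · filter_upwards [ae_tendsto_empirical P] with ω hω
    filter_upwards [hω hU] with T hT
    exact iff_of_true hT (Set.mem_univ ω)

end Law

/-! ### Exponential rates -/

section Rates

variable {a : ℕ+ → ℝ} {r : ℝ}

lemma eventually_pos_of_tendsto_div (hr : 0 < r)
    (har : Tendsto (fun T : ℕ+ => a T / ((T : ℕ) : ℝ)) atTop (𝓝 r)) : ∀ᶠ T in atTop, 0 < a T := by
  filter_upwards [har.eventually (lt_mem_nhds hr)] with T hT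
  exact (div_pos_iff_of_pos_right (by exact_mod_cast T.pos)).1 hT

lemma tendsto_div_speed (hr : 0 < r)
    (har : Tendsto (fun T : ℕ+ => a T / ((T : ℕ) : ℝ)) atTop (𝓝 r)) {b : ℕ+ → ℝ} {c : ℝ}
    (hb : Tendsto (fun T : ℕ+ => b T / ((T : ℕ) : ℝ)) atTop (𝓝 c)) :
    Tendsto (fun T => b T / a T) atTop (𝓝 (c / r)) :=
  (hb.div har hr.ne').congr fun T =>
    div_div_div_cancel_right₀ (by exact_mod_cast T.ne_zero) _ _

lemma limsup_log_div_le (hr : 0 < r)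
    (har : Tendsto (fun T : ℕ+ => a T / ((T : ℕ) : ℝ)) atTop (𝓝 r)) {m : ℕ+ → ENNReal}
    {b : ℕ+ → ℝ} {c : ℝ} (hb : Tendsto (fun T : ℕ+ => b T / ((T : ℕ) : ℝ)) atTop (𝓝 c))
    (hm : ∀ T, m T ≤ ENNReal.ofReal (Real.exp (b T))) :
    limsup (fun T => ENNReal.log (m T) / (a T : EReal)) atTop ≤ ((c / r : ℝ) : EReal) := by
  have hlim : Tendsto (fun T => ((b T / a T : ℝ) : EReal)) atTop (𝓝 ((c / r : ℝ) : EReal)) :=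
    (continuous_coe_real_ereal.tendsto _).comp (tendsto_div_speed hr har hb)
  rw [← hlim.limsup_eq]
  refine limsup_le_limsup ?_
  filter_upwards [eventually_pos_of_tendsto_div hr har] with T hT
  rw [EReal.coe_div]
  refine EReal.div_le_div_right_of_nonneg (by exact_mod_cast hT.le) ?_
  refine (ENNReal.log_le_log (hm T)).trans_eq ?_
  rw [ENNReal.log_ofReal_of_pos (Real.exp_pos _), Real.log_exp]

lemma le_limsup_log_div (hr : 0 < r)
    (har : Tendsto (fun T : ℕ+ => a T / ((T : ℕ) : ℝ)) atTop (𝓝 r)) {m : ℕ+ → ENNReal}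
    {b : ℕ+ → ℝ} {c c' : ℝ} (hb : Tendsto (fun T : ℕ+ => b T / ((T : ℕ) : ℝ)) atTop (𝓝 c))
    (hc : c' < c / r) (hm : ∃ᶠ T in atTop, ENNReal.ofReal (Real.exp (b T)) ≤ m T) :
    (c' : EReal) ≤ limsup (fun T => ENNReal.log (m T) / (a T : EReal)) atTop := by
  refine le_limsup_of_frequently_le' ?_
  refine (hm.and_eventually ((eventually_pos_of_tendsto_div hr har).and
    ((tendsto_div_speed hr har hb).eventually (lt_mem_nhds hc)))).mono ?_
  rintro T ⟨h1, hT, h2⟩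
  refine (EReal.coe_le_coe_iff.2 h2.le).trans ?_
  rw [EReal.coe_div]
  refine EReal.div_le_div_right_of_nonneg (by exact_mod_cast hT.le) ?_
  refine Eq.trans_le ?_ (ENNReal.log_le_log h1)
  rw [ENNReal.log_ofReal_of_pos (Real.exp_pos _), Real.log_exp]

lemma tendsto_log_add_one_div :
    Tendsto (fun T : ℕ+ => Real.log ((T : ℕ) + 1) / ((T : ℕ) : ℝ)) atTop (𝓝 0) := by
  have h1 : Tendsto (fun T : ℕ+ => ((T : ℕ) : ℝ) + 1) atTop atTop :=
    tendsto_atTop_add_const_right _ _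
      (tendsto_natCast_atTop_atTop.comp tendsto_PNat_val_atTop_atTop)
  refine ((Real.tendsto_pow_log_div_mul_add_atTop 1 (-1) 1 one_ne_zero).comp h1).congr fun T => ?_
  simp

end Rates

/-! ### Guarantee and optimality of the Kullback–Leibler predictor -/

section Optimality

variable {X S : Type*} [Fintype S] [MeasurableSpace S] [DiscreteMeasurableSpace S]
  {ℓ : X → S → ℝ} {r : ℝ} {a : ℕ+ → ℝ}

/-- The predictor can underestimate the cost only when the true distribution lies outside the
entropy ball around the empirical one. -/
theorem outOfSampleGuarantee_klPredictor (ℓ : X → S → ℝ) (hr : 0 < r)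
    (har : Tendsto (fun T : ℕ+ => a T / ((T : ℕ) : ℝ)) atTop (𝓝 r)) :
    OutOfSampleGuarantee ℓ a Set.univ (klPredictor ℓ r) := by
  intro x P _
  have hb : Tendsto (fun T : ℕ+ => (Fintype.card S * Real.log ((T : ℕ) + 1) - r * (T : ℕ))
      / ((T : ℕ) : ℝ)) atTop (𝓝 (-r)) := by
    have h := (tendsto_log_add_one_div.const_mul (Fintype.card S : ℝ)).sub_const r
    rw [mul_zero, zero_sub] at h
    refine h.congr fun T => ?_
    have hT : ((T : ℕ) : ℝ) ≠ 0 := by exact_mod_cast T.ne_zero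
    field_simp
  have hle := limsup_log_div_le hr har hb
    (m := fun T => sampleMeasure P {ω | cost ℓ x P > klPredictor ℓ r x (empirical T ω) T})
    fun T => ?_
  · rwa [neg_div, div_self hr.ne', EReal.coe_neg, EReal.coe_one] at hle
  · refine (measure_mono ?_).trans ((sampleMeasure_lt_relEntropy_le P T r).trans_eq ?_)
    · intro ω hω h
      exact (cost_le_klPredictor ℓ x T h).not_gt hω
    · have hT : (0 : ℝ) < (T : ℕ) + 1 := by positivity
      rw [sub_eq_add_neg, Real.exp_add, mul_comm (Fintype.card S : ℝ), Real.exp_mul,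
        Real.exp_log hT, Real.rpow_natCast]

/-- A predictor lying infinitely often, by a fixed margin, below the entropy-robust one violates
the guarantee: some `R` strictly inside the entropy ball has a cost above the prediction, and
samples from `R` look like samples from `P` with probability at least `exp (-b T)`, `b < r`. -/
lemma not_outOfSampleGuarantee_of_frequently_lt [TopologicalSpace X] (hr : 0 < r)
    (har : Tendsto (fun T : ℕ+ => a T / ((T : ℕ) : ℝ)) atTop (𝓝 r)) {chat : Predictor X S}
    (hchat : IsBoundedEquicontinuous chat) {x : X} {P : Simplex S} (hP : P ∈ simplexInterior S)
    {δ : ℝ} (hδ : 0 < δ) (hfreq : ∃ᶠ T in atTop, chat x P T < klPredictor ℓ r x P T - δ) :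
    ¬ OutOfSampleGuarantee ℓ a (simplexInterior S) chat := by
  intro hoos
  obtain ⟨Q, hQ, hQc⟩ := exists_cost_eq_klPredictor ℓ hr.le x P 1
  obtain ⟨R, hR, hRr, hRc⟩ := exists_interior_of_lt_cost ℓ x hr hQ
    (show cost ℓ x Q - δ / 2 < cost ℓ x Q by linarith)
  obtain ⟨b, hRb, hbr⟩ := exists_between hRr
  set A : Set (Simplex S) := {P' | (∀ T, dist (chat x P T) (chat x P' T) < δ / 2) ∧
    ∑ i, P' i * Real.log (P i / R i) < b} with hA
  have hAnhds : A ∈ 𝓝 P := by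
    have h1 := Metric.equicontinuousAt_iff_right.1 (hchat.equicontinuous (x, P)) (δ / 2)
      (half_pos hδ)
    have h2 : Tendsto (fun P' : Simplex S => (x, P')) (𝓝 P) (𝓝 (x, P)) :=
      (by fun_prop : Continuous fun P' : Simplex S => (x, P')).tendsto P
    have h3 : Continuous fun P' : Simplex S => ∑ i, P' i * Real.log (P i / R i) := by fun_prop
    exact (h2.eventually h1).and (h3.continuousAt.eventually (gt_mem_nhds hRb))
  have hb : Tendsto (fun T : ℕ+ => (-(b * (T : ℕ)) + Real.log (1 / 2)) / ((T : ℕ) : ℝ)) atTop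
      (𝓝 (-b)) := by
    have h := ((tendsto_const_nhds (x := Real.log (1 / 2))).div_atTop
      (tendsto_natCast_atTop_atTop.comp tendsto_PNat_val_atTop_atTop)).const_add (-b)
    rw [add_zero] at h
    refine h.congr fun T => ?_
    have hT : ((T : ℕ) : ℝ) ≠ 0 := by exact_mod_cast T.ne_zero
    simp only [Function.comp_apply]
    field_simp
  have hbr' : -1 < -b / r := by
    rw [lt_div_iff₀ hr]
    linarith
  obtain ⟨c', hc1, hc2⟩ := exists_between hbr'
  have hlow := le_limsup_log_div hr har hb hc2
    (m := fun T => sampleMeasure R {ω | cost ℓ x R > chat x (empirical T ω) T}) ?_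
  · have := hlow.trans (hoos x R hR)
    rw [← EReal.coe_one, ← EReal.coe_neg, EReal.coe_le_coe_iff] at this
    exact this.not_gt hc1
  · have hhalf := (tendsto_sampleMeasure_empirical_mem hAnhds).eventually
      (le_mem_nhds (show ENNReal.ofReal (1 / 2) < 1 by
        rw [← ENNReal.ofReal_one]
        exact (ENNReal.ofReal_lt_ofReal_iff one_pos).2 (by norm_num)))
    refine (hfreq.and_eventually hhalf).mono ?_
    rintro T ⟨hT, hTA⟩
    calc ENNReal.ofReal (Real.exp (-(b * (T : ℕ)) + Real.log (1 / 2)))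
        = ENNReal.ofReal (Real.exp (-(b * (T : ℕ)))) * ENNReal.ofReal (1 / 2) := by
          rw [Real.exp_add, Real.exp_log (by norm_num), ENNReal.ofReal_mul (Real.exp_pos _).le]
      _ ≤ ENNReal.ofReal (Real.exp (-(b * (T : ℕ)))) * sampleMeasure P {ω | empirical T ω ∈ A} :=
          mul_le_mul_right hTA _
      _ ≤ sampleMeasure R {ω | empirical T ω ∈ A} :=
          sampleMeasure_change hP hR T fun P' hP' => hP'.2.le
      _ ≤ _ := by
          refine measure_mono fun ω hω => ?_
          have h1 := (abs_lt.1 (Real.dist_eq _ _ ▸ hω.1 T)).1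
          have h2 : cost ℓ x Q = klPredictor ℓ r x P T := hQc
          change chat x (empirical T ω) T < cost ℓ x R
          linarith

theorem preferred_klPredictor [TopologicalSpace X] (hr : 0 < r)
    (har : Tendsto (fun T : ℕ+ => a T / ((T : ℕ) : ℝ)) atTop (𝓝 r)) {chat : Predictor X S}
    (hchat : IsBoundedEquicontinuous chat)
    (hoos : OutOfSampleGuarantee ℓ a (simplexInterior S) chat) :
    Preferred ℓ (klPredictor ℓ r) chat := by
  intro x P hP
  by_contra hlt
  obtain ⟨β, hβ1, hβ⟩ := exists_between (not_le.1 hlt)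
  have hβtop : β ≠ ⊤ := (hβ.trans_le le_top).ne
  set D := klPredictor ℓ r x P 1 - cost ℓ x P with hD
  have hD0 : 0 ≤ D := sub_nonneg.2 (cost_le_klPredictor ℓ x 1 (relEntropy_self_le P hr.le))
  -- the prediction does not depend on `T`, so neither does the numerator of the ratio
  have hfreq : ∃ᶠ T in atTop, β < ratio (ENNReal.ofReal D)
      (ENNReal.ofReal |chat x P T - cost ℓ x P|) := by
    have := frequently_lt_of_lt_limsup (by isBoundedDefault) hβ
    refine this.mono fun T hT => ?_
    rw [hD, ← abs_of_nonneg (a := klPredictor ℓ r x P 1 - cost ℓ x P) hD0]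
    exact hT
  have hβ1' : 1 < β.toReal := by
    rw [← ENNReal.toReal_one]
    exact (ENNReal.toReal_lt_toReal ENNReal.one_ne_top hβtop).2 hβ1
  have key : ∀ T, β < ratio (ENNReal.ofReal D) (ENNReal.ofReal |chat x P T - cost ℓ x P|) →
      0 < D ∧ |chat x P T - cost ℓ x P| < D / β.toReal := by
    intro T hT
    have hDpos : 0 < D := by
      refine lt_of_le_of_ne hD0 fun h0 => hT.not_ge (le_trans ?_ hβ1.le)
      rw [← h0, ENNReal.ofReal_zero, ratio]
      split_ifs <;> simp
    refine ⟨hDpos, ?_⟩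
    rw [ratio, if_neg fun h => hDpos.not_ge (ENNReal.ofReal_eq_zero.1 h.1)] at hT
    have h1 := ENNReal.mul_lt_of_lt_div hT
    rw [← ENNReal.ofReal_toReal hβtop, ← ENNReal.ofReal_mul ENNReal.toReal_nonneg,
      ENNReal.ofReal_lt_ofReal_iff hDpos] at h1
    rw [lt_div_iff₀ (by linarith)]
    linarith
  obtain ⟨T₀, hT₀⟩ := hfreq.exists
  have hDpos := (key T₀ hT₀).1
  have hδ : 0 < D - D / β.toReal := sub_pos.2 (div_lt_self hDpos hβ1')
  refine not_outOfSampleGuarantee_of_frequently_lt (x := x) hr har hchat hP hδ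
    (hfreq.mono fun T hT => ?_) hoos
  have h1 := (abs_lt.1 (key T hT).2).2
  have h2 : klPredictor ℓ r x P T = klPredictor ℓ r x P 1 := rfl
  rw [h2]
  linarith

end Optimality

end DataDriven

theorem mainTheorem3 {X S : Type*} [TopologicalSpace X] [CompactSpace X]
    [Fintype S] [MeasurableSpace S] [DiscreteMeasurableSpace S]
    (ℓ : X → S → ℝ) (hℓ : ∀ i : S, Continuous (fun x => ℓ x i))
    (r : ℝ) (hr : 0 < r) (a : ℕ+ → ℝ) (ha : ∀ T, 0 ≤ a T)
    (har : Tendsto (fun T : ℕ+ => a T / ((T : ℕ) : ℝ)) atTop (𝓝 r)) :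
    DataDriven.IsRegularPredictor (DataDriven.klPredictor ℓ r) ∧
    DataDriven.OutOfSampleGuarantee ℓ a Set.univ (DataDriven.klPredictor ℓ r) ∧
    ∀ chat : DataDriven.Predictor X S,
      DataDriven.IsBoundedEquicontinuous chat →
      DataDriven.OutOfSampleGuarantee ℓ a (DataDriven.simplexInterior S) chat →
      DataDriven.Preferred ℓ (DataDriven.klPredictor ℓ r) chat := by
  exact ⟨DataDriven.isRegularPredictor_klPredictor hℓ hr,
    DataDriven.outOfSampleGuarantee_klPredictor ℓ hr har,
    fun _ hchat hoos => DataDriven.preferred_klPredictor hr har hchat hoos⟩
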